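/- Let $n,p\ge 1$ be integers and let $X=(X_{kl})$ be a random $n\times p$ matrix following the Bernoulli-Subgaussian model with parameter $\theta$, i.e. $X_{kl}=\chi_{kl}R_{kl}$, where all the random variables $\chi_{kl},R_{kl}$ ($1\le k\le n$, $1\le l\le p$) are independent, $\mathbb{P}(\chi_{kl}=1)=1-\mathbb{P}(\chi_{kl}=0)=\theta$, and the $R_{kl}$ are identically distributed with $\mathbb{E}R_{kl}=0$, $\mathbb{E}|R_{kl}|\ge 1/10$ and $\mathbb{P}(|R_{kl}|\ge t)\le 2e^{-t^2/2}$ for all $t>0$. For $1\le i<j\le p$ put $$b_{ij}=Xe_i+Xe_j\in\mathbb{R}^n,\qquad I_{ij}=\operatorname{supp}(Xe_i)\cup\operatorname{supp}(Xe_j)\subseteq\{1,\dots,n\},$$ where $e_1,\dots,e_p$ is the standard basis of $\mathbb{R}^p$. There exist numerical constants $C,\alpha>0$ (independent of $n$, $p$, $\theta$ and the distribution of the $R_{kl}$) such that if $2/n\le\theta\le\alpha/\sqrt n$ and $p>Cn\log n$, then with probability at least $1-p^{-2}$ the random matrix $X$ has the following property: for every $1\le i<j\le p$, either $|I_{ij}|\in\{0\}\cup(1/(8\theta),n]$,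 or every solution $z_\ast\in\mathbb{R}^n$ of the optimization problem $$\text{minimize } \|z^TX\|_1 \text{ over } z\in\mathbb{R}^n \text{ subject to } b_{ij}^Tz=1$$ satisfies $\operatorname{supp} z_\ast\subseteq I_{ij}$. -/

import Mathlib

open MeasureTheory ProbabilityTheory

/-- The `ℓ¹` norm of a vector of finite length. -/
def l1Norm {m : ℕ} (v : Fin m → ℝ) : ℝ := ∑ l, |v l|

/-- The random matrix with entries `X k l = χ k l * R k l`. -/
def sparseMatrix {Ω : Type*} {n p : ℕ} (χ R : Fin n → Fin p → Ω → ℝ) (ω : Ω) :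
    Matrix (Fin n) (Fin p) ℝ :=
  Matrix.of fun k l => χ k l ω * R k l ω

/-- The Bernoulli-Subgaussian model with parameter `θ`: all the variables `χ k l`, `R k l` are
jointly independent, every `χ k l` is Bernoulli with parameter `θ`, and the `R k l` are identically
distributed with mean zero, first absolute moment at least `1 / 10` and
`P (|R k l| ≥ t) ≤ 2 exp (- t ^ 2 / 2)` for all `t > 0`. -/
structure BernoulliSubgaussian {Ω : Type*} [MeasurableSpace Ω] (P : Measure Ω) (θ : ℝ) {n p : ℕ}
    (χ R : Fin n → Fin p → Ω → ℝ) : Prop where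
  measurable_χ : ∀ k l, Measurable (χ k l)
  measurable_R : ∀ k l, Measurable (R k l)
  indep : iIndepFun
    (Sum.elim (fun a : Fin n × Fin p => χ a.1 a.2) (fun a : Fin n × Fin p => R a.1 a.2)) P
  prob_χ_one : ∀ k l, P.real {ω | χ k l ω = 1} = θ
  prob_χ_zero : ∀ k l, P.real {ω | χ k l ω = 0} = 1 - θ
  identDistrib_R : ∀ k l k' l', IdentDistrib (R k l) (R k' l') P P
  integrable_R : ∀ k l, Integrable (R k l) P
  mean_R : ∀ k l, ∫ ω, R k l ω ∂P = 0
  abs_mean_R : ∀ k l, 1 / 10 ≤ ∫ ω, |R k l ω| ∂P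
  tail_R : ∀ k l, ∀ t : ℝ, 0 < t → P.real {ω | t ≤ |R k l ω|} ≤ 2 * Real.exp (-t ^ 2 / 2)

/-- The vector `b_{ij} = X e_i + X e_j`, the sum of two columns of `X`. -/
def pairSum {n p : ℕ} (X : Matrix (Fin n) (Fin p) ℝ) (i j : Fin p) : Fin n → ℝ :=
  X.col i + X.col j

/-- The set `I_{ij} = supp (X e_i) ∪ supp (X e_j)`. -/
def pairSupport {n p : ℕ} (X : Matrix (Fin n) (Fin p) ℝ) (i j : Fin p) : Set (Fin n) :=
  Function.support (X.col i) ∪ Function.support (X.col j)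

/-- `z` solves the problem: minimize `‖zᵀ X‖₁` subject to `bᵀ z = 1`. -/
def IsL1Solution {n p : ℕ} (X : Matrix (Fin n) (Fin p) ℝ) (b z : Fin n → ℝ) : Prop :=
  b ⬝ᵥ z = 1 ∧ ∀ w : Fin n → ℝ, b ⬝ᵥ w = 1 → l1Norm (Matrix.vecMul z X) ≤ l1Norm (Matrix.vecMul w X)

/-- Property (P1): for all `i < j`, either `|I_{ij}|` is `0` or lies in `(1 / (8 θ), n]`, or every
solution of the problem with constraint vector `b_{ij}` is supported in `I_{ij}`. -/
def PropertyP1 {n p : ℕ} (θ : ℝ) (X : Matrix (Fin n) (Fin p) ℝ) : Prop :=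
  ∀ i j : Fin p, i < j →
    ((pairSupport X i j).ncard = 0 ∨
      (1 / (8 * θ) < ((pairSupport X i j).ncard : ℝ) ∧ (pairSupport X i j).ncard ≤ n)) ∨
    ∀ z : Fin n → ℝ, IsL1Solution X (pairSum X i j) z → Function.support z ⊆ pairSupport X i j

/-! Fix `i < j`, put `I = I_{ij}`, and split a solution as `z = z_I + v` with `v` vanishing on `I`.
The constraint does not see `v`, and neither do columns `i` and `j`. On a column vanishing on `I`
the value of `z` is that of `v`; on any other column, discarding `v` costs at most `|v ⬝ᵥ x|`. So
`z_I` is strictly better than `z` unless `v = 0`, provided `∑ ± |v ⬝ᵥ x l| > 0` over the remaining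
columns, with sign `+` exactly for columns vanishing on `I` (`IsL1Solution.support_subset`).

This sum is positive on average. If `θ |I| ≤ 1/8`, a column meets `I` with probability at most
`1/8`, independently of `v ⬝ᵥ x`, so the signed mean is at least `3/4` of `E|v ⬝ᵥ x|`
(`integral_vanishSign_mul`). In turn `E|v ⬝ᵥ x|` is at least a constant times `√(θ/n) ‖v‖₁`
(`le_integral_abs_dotProduct`), by testing against a truncated linear functional.

Uniformity in `v` needs no net. Symmetrization and contraction, applied to the exponential moment
one column at a time, replace the supremum of the signed sums by a supremum of linear functionals
over an `ℓ¹` ball. By duality this is a maximum over `n` coordinates, and costs only a factor `2n`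
(`lintegral_expSupDev_le`). The failure probability is `2n exp(-κ(p-2)/n)`.

The set `I` is random but depends only on columns `i` and `j`, which are independent of the others.
The bound is therefore proved on each event `I_{ij} = I` with its probability as a factor, and
summing over `I` loses nothing. A union bound over pairs then costs `p²`, which `p > C n log n`
absorbs. -/

/-! ### Moments of a single entry. -/

/-- Layer cake: levels `t ≤ 1` contribute at most `1`, and for `t > 1` the tail at `√(8 log t)` is
at most `2 t⁻⁴`, which integrates to `2/3`. -/
theorem lintegral_exp_sq_le_of_tail {ρ : Measure ℝ} [IsProbabilityMeasure ρ]
    (htail : ∀ t : ℝ, 0 < t → ρ.real {x | t ≤ |x|} ≤ 2 * Real.exp (-t ^ 2 / 2)) :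
    ∫⁻ x, ENNReal.ofReal (Real.exp (x ^ 2 / 8)) ∂ρ ≤ ENNReal.ofReal (5 / 3) := by
  rw [lintegral_eq_lintegral_meas_le ρ (Filter.Eventually.of_forall fun x => (Real.exp_pos _).le)
    (by fun_prop)]
  rw [← Set.Ioc_union_Ioi_eq_Ioi (zero_le_one (α := ℝ)),
    lintegral_union measurableSet_Ioi (Set.Ioc_disjoint_Ioi le_rfl)]
  have h1 : ∫⁻ t in Set.Ioc (0 : ℝ) 1, ρ {x | t ≤ Real.exp (x ^ 2 / 8)} ≤ 1 := by
    calc _ ≤ ∫⁻ _ in Set.Ioc (0 : ℝ) 1, 1 := lintegral_mono fun t => prob_le_one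
      _ = 1 := by simp
  have h2 : ∫⁻ t in Set.Ioi (1 : ℝ), ρ {x | t ≤ Real.exp (x ^ 2 / 8)} ≤
      ENNReal.ofReal (2 / 3) := by
    calc _ ≤ ∫⁻ t in Set.Ioi (1 : ℝ), ENNReal.ofReal (2 * t ^ (-4 : ℝ)) := by
          refine setLIntegral_mono (by fun_prop) fun t ht => ?_
          have ht1 : (1 : ℝ) < t := ht
          have hlog : 0 < Real.log t := Real.log_pos ht1
          have hsub : {x : ℝ | t ≤ Real.exp (x ^ 2 / 8)} ⊆ {x | √(8 * Real.log t) ≤ |x|} := by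
            intro x hx
            have hx' := (Real.log_le_iff_le_exp (by linarith)).2 hx
            rw [Set.mem_ofPred_eq, Real.sqrt_le_left (abs_nonneg x), sq_abs]
            linarith
          refine (measure_mono hsub).trans ?_
          rw [← ofReal_measureReal]
          refine ENNReal.ofReal_le_ofReal ((htail _ (Real.sqrt_pos.2 (by linarith))).trans ?_)
          rw [Real.sq_sqrt (by linarith), Real.rpow_def_of_pos (by linarith)]
          apply le_of_eq
          congr 2
          ring
      _ = ENNReal.ofReal (∫ t in Set.Ioi (1 : ℝ), 2 * t ^ (-4 : ℝ)) := by
          refine (ofReal_integral_eq_lintegral_ofReal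
            ((integrableOn_Ioi_rpow_of_lt (by norm_num) one_pos).const_mul 2) ?_).symm
          filter_upwards [ae_restrict_mem measurableSet_Ioi] with t ht
          have : (0 : ℝ) < t := zero_lt_one.trans ht
          positivity
      _ = ENNReal.ofReal (2 / 3) := by
          rw [integral_const_mul, integral_Ioi_rpow_of_lt (by norm_num) one_pos]
          norm_num
  calc _ ≤ 1 + ENNReal.ofReal (2 / 3) := add_le_add h1 h2
    _ = ENNReal.ofReal (5 / 3) := by
      rw [← ENNReal.ofReal_one, ← ENNReal.ofReal_add (by norm_num) (by norm_num)]
      norm_num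

/-- The moment bounds satisfied by the law of an entry of a sparse random matrix. -/
structure SparseMoments (ν : Measure ℝ) (θ : ℝ) : Prop where
  integrable_sq : Integrable (fun x => x ^ 2) ν
  mean : ∫ x, x ∂ν = 0
  sq_le : ∫ x, x ^ 2 ∂ν ≤ 6 * θ
  le_abs : θ / 10 ≤ ∫ x, |x| ∂ν
  nonzero_le : ν.real {x | x ≠ 0} ≤ θ
  cosh_le : ∀ a : ℝ, |a| ≤ 1 / 2 →
    ∫⁻ x, ENNReal.ofReal (Real.cosh (a * x)) ∂ν ≤ ENNReal.ofReal (Real.exp (3 * θ * a ^ 2))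

/-- Since `cosh y ≤ exp (y²/2)`, the left side is at most `exp` at the point `4a² · (x²/8)`, which
lies under the chord of `exp` from `0` to `x²/8` because `4a² ≤ 1`. The gain over a crude bound is
that the excess above `1` is of order `a²`. -/
theorem cosh_mul_le (a x : ℝ) (ha : |a| ≤ 1 / 2) :
    Real.cosh (a * x) ≤ (1 - 4 * a ^ 2) + 4 * a ^ 2 * Real.exp (x ^ 2 / 8) := by
  have ha2 : a ^ 2 ≤ 1 / 4 := by
    rw [← sq_abs]; nlinarith [abs_nonneg a]
  have h := convexOn_exp.2 (Set.mem_univ 0) (Set.mem_univ (x ^ 2 / 8))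
    (show 0 ≤ 1 - 4 * a ^ 2 by linarith) (show 0 ≤ 4 * a ^ 2 by positivity) (by ring)
  simp only [smul_eq_mul, Real.exp_zero, mul_zero, zero_add, mul_one] at h
  refine (Real.cosh_le_exp_half_sq _).trans (le_trans (le_of_eq ?_) h)
  congr 1
  ring

theorem sparseMoments_of_tail {ρ : Measure ℝ} [IsProbabilityMeasure ρ] {θ : ℝ}
    (h0 : 0 ≤ θ) (h1 : θ ≤ 1) (hint : Integrable (fun x => x) ρ) (hmean : ∫ x, x ∂ρ = 0)
    (habs : 1 / 10 ≤ ∫ x, |x| ∂ρ)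
    (htail : ∀ t : ℝ, 0 < t → ρ.real {x | t ≤ |x|} ≤ 2 * Real.exp (-t ^ 2 / 2)) :
    SparseMoments (ENNReal.ofReal (1 - θ) • Measure.dirac 0 + ENNReal.ofReal θ • ρ) θ := by
  have hexp := lintegral_exp_sq_le_of_tail htail
  have hexpint : Integrable (fun x : ℝ => Real.exp (x ^ 2 / 8)) ρ := by
    refine ⟨by fun_prop, ?_⟩
    rw [hasFiniteIntegral_iff_ofReal (Filter.Eventually.of_forall fun x => (Real.exp_pos _).le)]
    exact hexp.trans_lt ENNReal.ofReal_lt_top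
  have hexple : ∫ x, Real.exp (x ^ 2 / 8) ∂ρ ≤ 5 / 3 := by
    rw [← ENNReal.ofReal_le_ofReal_iff (by norm_num), ofReal_integral_eq_lintegral_ofReal hexpint
      (Filter.Eventually.of_forall fun x => (Real.exp_pos _).le)]
    exact hexp
  have hsqle : ∀ x : ℝ, x ^ 2 ≤ 8 * (Real.exp (x ^ 2 / 8) - 1) := fun x => by
    have := Real.add_one_le_exp (x ^ 2 / 8)
    linarith
  have hdom : Integrable (fun x : ℝ => 8 * (Real.exp (x ^ 2 / 8) - 1)) ρ :=
    (hexpint.sub (integrable_const 1)).const_mul 8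
  have hsqint : Integrable (fun x : ℝ => x ^ 2) ρ := by
    refine hdom.mono' (by fun_prop) (Filter.Eventually.of_forall fun x => ?_)
    rw [Real.norm_of_nonneg (sq_nonneg x)]
    exact hsqle x
  have hsq : ∫ x, x ^ 2 ∂ρ ≤ 6 := by
    calc _ ≤ ∫ x, 8 * (Real.exp (x ^ 2 / 8) - 1) ∂ρ := integral_mono hsqint hdom hsqle
      _ = 8 * (∫ x, Real.exp (x ^ 2 / 8) ∂ρ - 1) := by
        rw [integral_const_mul, integral_sub hexpint (integrable_const 1)]; simp
      _ ≤ 6 := by linarith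
  have hd : ∀ f : ℝ → ℝ, Integrable f (ENNReal.ofReal (1 - θ) • Measure.dirac (0 : ℝ)) := fun f =>
    (integrable_dirac (by simp)).smul_measure ENNReal.ofReal_ne_top
  have hval : ∀ f : ℝ → ℝ, Integrable f ρ → f 0 = 0 →
      ∫ x, f x ∂(ENNReal.ofReal (1 - θ) • Measure.dirac (0 : ℝ) + ENNReal.ofReal θ • ρ) =
        θ * ∫ x, f x ∂ρ := fun f hf hf0 => by
    rw [integral_add_measure (hd f) (hf.smul_measure ENNReal.ofReal_ne_top),
      integral_smul_measure, integral_smul_measure, integral_dirac, hf0,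
      ENNReal.toReal_ofReal h0]
    simp
  refine ⟨(hd _).add_measure (hsqint.smul_measure ENNReal.ofReal_ne_top), ?_, ?_, ?_, ?_, ?_⟩
  · rw [hval _ hint rfl, hmean, mul_zero]
  · rw [hval _ hsqint (by simp)]
    nlinarith
  · rw [hval _ hint.abs (by simp)]
    nlinarith
  · rw [measureReal_def]
    refine ENNReal.toReal_le_of_le_ofReal h0 ?_
    have hm : MeasurableSet {x : ℝ | x ≠ 0} := (measurableSet_singleton 0).compl
    rw [Measure.add_apply, Measure.smul_apply, Measure.smul_apply, Measure.dirac_apply' _ hm]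
    simp only [Set.mem_ofPred_eq, ne_eq, not_true_eq_false, not_false_eq_true,
      Set.indicator_of_notMem, smul_eq_mul, mul_zero, zero_add]
    exact mul_le_of_le_one_right' prob_le_one
  · intro a ha
    have ha2 : a ^ 2 ≤ 1 / 4 := by
      rw [← sq_abs]; nlinarith [abs_nonneg a]
    have hρ : ∫⁻ x, ENNReal.ofReal (Real.cosh (a * x)) ∂ρ ≤
        ENNReal.ofReal (1 + 8 / 3 * a ^ 2) := by
      calc _ ≤ ∫⁻ x, ENNReal.ofReal
            ((1 - 4 * a ^ 2) + 4 * a ^ 2 * Real.exp (x ^ 2 / 8)) ∂ρ :=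
            lintegral_mono fun x => ENNReal.ofReal_le_ofReal (cosh_mul_le a x ha)
        _ = ENNReal.ofReal (∫ x, ((1 - 4 * a ^ 2) + 4 * a ^ 2 * Real.exp (x ^ 2 / 8)) ∂ρ) := by
            refine (ofReal_integral_eq_lintegral_ofReal
              ((integrable_const _).add (hexpint.const_mul _))
              (Filter.Eventually.of_forall fun x => ?_)).symm
            have : 0 ≤ 1 - 4 * a ^ 2 := by linarith
            exact add_nonneg this (by positivity)
        _ ≤ _ := by
            refine ENNReal.ofReal_le_ofReal ?_
            rw [integral_add (integrable_const _) (hexpint.const_mul _), integral_const_mul]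
            simp only [integral_const, probReal_univ, one_smul]
            nlinarith [sq_nonneg a]
    rw [lintegral_add_measure, lintegral_smul_measure, lintegral_smul_measure, lintegral_dirac]
    simp only [mul_zero, Real.cosh_zero, ENNReal.ofReal_one, smul_eq_mul, mul_one]
    calc _ ≤ ENNReal.ofReal (1 - θ) + ENNReal.ofReal θ * ENNReal.ofReal (1 + 8 / 3 * a ^ 2) := by
          gcongr
      _ = ENNReal.ofReal (1 - θ + θ * (1 + 8 / 3 * a ^ 2)) := by
          rw [← ENNReal.ofReal_mul h0, ← ENNReal.ofReal_add (by linarith) (by positivity)]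
      _ ≤ _ := by
          refine ENNReal.ofReal_le_ofReal ?_
          have := Real.add_one_le_exp (3 * θ * a ^ 2)
          nlinarith [mul_nonneg h0 (sq_nonneg a)]

/-! ### The joint law of the columns. -/

/-- The law of the product of a Bernoulli variable and an independent variable. -/
theorem map_mul_bernoulli {Ω : Type*} [MeasurableSpace Ω] {P : Measure Ω} [IsProbabilityMeasure P]
    {θ : ℝ} {χ R : Ω → ℝ} (hχ : Measurable χ) (hR : Measurable R) (hind : IndepFun χ R P)
    (hone : P.real {ω | χ ω = 1} = θ) (hzero : P.real {ω | χ ω = 0} = 1 - θ) :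
    P.map (fun ω => χ ω * R ω) =
      ENNReal.ofReal (1 - θ) • Measure.dirac 0 + ENNReal.ofReal θ • P.map R := by
  have m1 : MeasurableSet {ω | χ ω = 1} := hχ (measurableSet_singleton 1)
  have m0 : MeasurableSet {ω | χ ω = 0} := hχ (measurableSet_singleton 0)
  have hdisj : Disjoint {ω | χ ω = 0} {ω | χ ω = 1} := by
    rw [Set.disjoint_left]
    intro ω h0 h1
    simp only [Set.mem_ofPred_eq] at h0 h1
    linarith
  have hcompl : P ({ω | χ ω = 0} ∪ {ω | χ ω = 1})ᶜ = 0 := by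
    rw [prob_compl_eq_zero_iff (m0.union m1), ← ENNReal.toReal_eq_one_iff, ← measureReal_def,
      measureReal_union hdisj m1, hone, hzero]
    ring
  ext s hs
  rw [Measure.map_apply (by fun_prop) hs, Measure.add_apply, Measure.smul_apply,
    Measure.smul_apply, Measure.map_apply hR hs, Measure.dirac_apply' _ hs, ← hzero, ← hone,
    ofReal_measureReal, ofReal_measureReal]
  have hA : MeasurableSet ((fun ω => χ ω * R ω) ⁻¹' s) := (hχ.mul hR) hs
  have hsplit : P ((fun ω => χ ω * R ω) ⁻¹' s) =
      P ({ω | χ ω = 0} ∩ (fun ω => χ ω * R ω) ⁻¹' s) +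
        P ({ω | χ ω = 1} ∩ (fun ω => χ ω * R ω) ⁻¹' s) := by
    rw [← measure_union (hdisj.mono Set.inter_subset_left Set.inter_subset_left) (m1.inter hA),
      ← Set.union_inter_distrib_right, Set.inter_comm, measure_inter_conull hcompl]
  rw [hsplit]
  congr 1
  · by_cases h : (0 : ℝ) ∈ s
    · rw [Set.indicator_of_mem h, Pi.one_apply, smul_eq_mul, mul_one]
      congr 1
      ext ω
      simp only [Set.mem_inter_iff, Set.mem_ofPred_eq, Set.mem_preimage, and_iff_left_iff_imp]
      intro h0
      rwa [h0, zero_mul]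
    · rw [Set.indicator_of_notMem h, smul_eq_mul, mul_zero]
      convert measure_empty (μ := P)
      ext ω
      simp only [Set.mem_inter_iff, Set.mem_ofPred_eq, Set.mem_preimage, Set.mem_empty_iff_false,
        iff_false, not_and]
      intro h0
      rwa [h0, zero_mul]
  · have := hind.measure_inter_preimage_eq_mul {1} s (measurableSet_singleton 1) hs
    rw [smul_eq_mul]
    refine Eq.trans ?_ this
    congr 1
    ext ω
    simp only [Set.mem_inter_iff, Set.mem_ofPred_eq, Set.mem_preimage, Set.mem_singleton_iff]
    refine and_congr_right fun h1 => ?_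
    rw [h1, one_mul]

theorem iIndepFun_curry {Ω ι κ : Type*} [Fintype ι] [Fintype κ] [MeasurableSpace Ω]
    {P : Measure Ω} {X : ι × κ → Ω → ℝ} (hX : ∀ a, Measurable (X a)) (h : iIndepFun X P) :
    iIndepFun (fun i ω j => X (i, j) ω) P := by
  have := h.isProbabilityMeasure
  have hp : ∀ a, IsProbabilityMeasure (P.map (X a)) := fun a =>
    Measure.isProbabilityMeasure_map (hX a).aemeasurable
  have hrow : ∀ i, P.map (fun ω j => X (i, j) ω) = Measure.pi fun j => P.map (X (i, j)) := fun i =>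
    (iIndepFun_iff_map_fun_eq_pi_map fun j => (hX (i, j)).aemeasurable).1
      (h.precomp (g := fun j => (i, j)) fun j j' hj => (Prod.mk.inj hj).2)
  have hjoint := (iIndepFun_iff_map_fun_eq_pi_map fun a => (hX a).aemeasurable).1 h
  have hc := Measure.infinitePi_map_curry (ι := ι) (κ := κ) (X := ℝ) fun i j => P.map (X (i, j))
  simp only [Measure.infinitePi_eq_pi] at hc
  rw [iIndepFun_iff_map_fun_eq_pi_map fun i => by fun_prop]
  simp only [hrow]
  rw [← hc, ← hjoint, Measure.map_map (MeasurableEquiv.measurable _) (by fun_prop)]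
  rfl

/-- Reindexing the joint family by `ι × Bool` groups each `χ a` with its `R a`; the pairs are
independent, and so are their products. -/
theorem iIndepFun_mul_of_sum {Ω ι : Type*} [Fintype ι] [MeasurableSpace Ω] {P : Measure Ω}
    {χ R : ι → Ω → ℝ} (hχ : ∀ a, Measurable (χ a)) (hR : ∀ a, Measurable (R a))
    (h : iIndepFun (Sum.elim χ R) P) : iIndepFun (fun a ω => χ a ω * R a ω) P := by
  have hm : ∀ b, Measurable (Sum.elim χ R b) := by
    rintro (a | a)
    · exact hχ a
    · exact hR a
  have hinj : Function.Injective
      fun a : ι × Bool => (bif a.2 then Sum.inl a.1 else Sum.inr a.1 : ι ⊕ ι) := by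
    rintro ⟨a, _ | _⟩ ⟨b, _ | _⟩ hab <;> simp_all
  have hpair := iIndepFun_curry (fun a => hm _) (h.precomp hinj)
  exact hpair.comp (fun _ y => y true * y false) fun _ => by fun_prop

theorem BernoulliSubgaussian.exists_law {Ω : Type*} [MeasurableSpace Ω] {P : Measure Ω}
    [IsProbabilityMeasure P] {n p : ℕ} {θ : ℝ} {χ R : Fin n → Fin p → Ω → ℝ}
    (hn : 0 < n) (hp : 0 < p) (h : BernoulliSubgaussian P θ χ R) :
    0 ≤ θ ∧ θ ≤ 1 ∧ ∃ ν : Measure ℝ, IsProbabilityMeasure ν ∧ SparseMoments ν θ ∧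
      P.map (fun ω (l : Fin p) (k : Fin n) => χ k l ω * R k l ω) =
        Measure.pi fun _ : Fin p => Measure.pi fun _ : Fin n => ν := by
  set k₀ : Fin n := ⟨0, hn⟩
  set l₀ : Fin p := ⟨0, hp⟩
  have h0 : 0 ≤ θ := h.prob_χ_one k₀ l₀ ▸ measureReal_nonneg
  have h1 : θ ≤ 1 := h.prob_χ_one k₀ l₀ ▸ measureReal_le_one
  have hmR := h.measurable_R k₀ l₀
  set ρ := P.map (R k₀ l₀) with hρ
  have : IsProbabilityMeasure ρ := Measure.isProbabilityMeasure_map hmR.aemeasurable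
  set ν := ENNReal.ofReal (1 - θ) • Measure.dirac (0 : ℝ) + ENNReal.ofReal θ • ρ with hν
  have hlaw : ∀ k l, P.map (fun ω => χ k l ω * R k l ω) = ν := fun k l => by
    have hi := h.indep.indepFun (i := Sum.inl (k, l)) (j := Sum.inr (k, l)) (by simp)
    rw [map_mul_bernoulli (h.measurable_χ k l) (h.measurable_R k l) hi (h.prob_χ_one k l)
      (h.prob_χ_zero k l), (h.identDistrib_R k l k₀ l₀).map_eq]
  have hνp : IsProbabilityMeasure ν := by
    rw [← hlaw k₀ l₀]
    exact Measure.isProbabilityMeasure_map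
      ((h.measurable_χ k₀ l₀).mul (h.measurable_R k₀ l₀)).aemeasurable
  refine ⟨h0, h1, ν, hνp, ?_, ?_⟩
  · refine sparseMoments_of_tail h0 h1 ?_ ?_ ?_ ?_
    · exact (integrable_map_measure (by fun_prop) hmR.aemeasurable).2 (h.integrable_R k₀ l₀)
    · rw [hρ, integral_map hmR.aemeasurable (by fun_prop)]
      exact h.mean_R k₀ l₀
    · rw [hρ, integral_map hmR.aemeasurable (by fun_prop)]
      exact h.abs_mean_R k₀ l₀
    · intro t ht
      rw [hρ, map_measureReal_apply hmR (measurableSet_le (by fun_prop) (by fun_prop))]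
      exact h.tail_R k₀ l₀ t ht
  · have hmeas : ∀ a : Fin p × Fin n, Measurable fun ω => χ a.2 a.1 ω * R a.2 a.1 ω := fun a =>
      (h.measurable_χ _ _).mul (h.measurable_R _ _)
    have hind : iIndepFun (fun (a : Fin p × Fin n) ω => χ a.2 a.1 ω * R a.2 a.1 ω) P :=
      (iIndepFun_mul_of_sum (fun a : Fin n × Fin p => h.measurable_χ a.1 a.2)
        (fun a => h.measurable_R a.1 a.2) h.indep).precomp
        (g := Prod.swap) Prod.swap_injective
    have hcol : ∀ l, P.map (fun ω k => χ k l ω * R k l ω) = Measure.pi fun _ : Fin n => ν := by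
      intro l
      have := (iIndepFun_iff_map_fun_eq_pi_map fun k => (hmeas (l, k)).aemeasurable).1
        (hind.precomp (g := fun k => (l, k)) fun k k' hk => (Prod.mk.inj hk).2)
      simpa only [hlaw] using this
    have hjoint := (iIndepFun_iff_map_fun_eq_pi_map fun l =>
      (measurable_pi_lambda _ fun k => hmeas (l, k)).aemeasurable).1 (iIndepFun_curry hmeas hind)
    simpa only [hcol] using hjoint

/-! ### Resampling one coordinate of a product measure. -/

section Resampling

variable {ι α : Type*} [Fintype ι] [DecidableEq ι] [MeasurableSpace α]

/-- Replacing a coordinate by a fresh independent copy does not change the law. This serves as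
conditioning on all the other coordinates, without splitting the product. -/
theorem measurePreserving_update_pi (μ : ι → Measure α) [∀ i, IsProbabilityMeasure (μ i)] (k : ι) :
    MeasurePreserving (fun z : (ι → α) × α => Function.update z.1 k z.2)
      ((Measure.pi μ).prod (μ k)) (Measure.pi μ) := by
  refine ⟨measurable_update', (Measure.pi_eq fun s hs => ?_).symm⟩
  rw [Measure.map_apply measurable_update' (MeasurableSet.univ_pi hs)]
  have hpre : (fun z : (ι → α) × α => Function.update z.1 k z.2) ⁻¹' Set.univ.pi s =
      Set.univ.pi (Function.update s k Set.univ) ×ˢ s k := by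
    ext ⟨x, y⟩
    simp only [Set.mem_preimage, Set.mem_pi, Set.mem_univ, true_imp_iff, Set.mem_prod]
    constructor
    · refine fun h => ⟨fun i => ?_, by simpa using h k⟩
      by_cases hi : i = k
      · subst hi; simp
      · simpa [hi] using h i
    · rintro ⟨h, hk⟩ i
      by_cases hi : i = k
      · subst hi; simpa using hk
      · simpa [hi] using h i
  rw [hpre, Measure.prod_prod, Measure.pi_pi, ← Finset.mul_prod_erase Finset.univ _ (Finset.mem_univ k),
    ← Finset.mul_prod_erase Finset.univ (fun i => μ i (s i)) (Finset.mem_univ k)]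
  rw [Function.update_self, measure_univ, one_mul, mul_comm]
  congr 1
  refine Finset.prod_congr rfl fun i hi => ?_
  rw [Function.update_of_ne (Finset.ne_of_mem_erase hi)]

theorem lintegral_pi_eq_lintegral_update (μ : ι → Measure α) [∀ i, IsProbabilityMeasure (μ i)]
    (k : ι) {f : (ι → α) → ENNReal} (hf : Measurable f) :
    ∫⁻ x, f x ∂Measure.pi μ = ∫⁻ x, ∫⁻ y, f (Function.update x k y) ∂μ k ∂Measure.pi μ := by
  rw [← (measurePreserving_update_pi μ k).lintegral_comp hf, lintegral_prod]
  exact (hf.comp measurable_update').aemeasurable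

theorem integral_pi_eq_integral_update (μ : ι → Measure α) [∀ i, IsProbabilityMeasure (μ i)]
    (k : ι) {f : (ι → α) → ℝ} (hi : Integrable f (Measure.pi μ)) :
    ∫ x, f x ∂Measure.pi μ = ∫ x, ∫ y, f (Function.update x k y) ∂μ k ∂Measure.pi μ := by
  have h := measurePreserving_update_pi μ k
  have hi' := h.integrable_comp_of_integrable hi
  calc _ = ∫ x, f x ∂((Measure.pi μ).prod (μ k)).map fun z => Function.update z.1 k z.2 := by
        rw [h.map_eq]
    _ = ∫ z, f (Function.update z.1 k z.2) ∂(Measure.pi μ).prod (μ k) :=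
        integral_map h.measurable.aemeasurable (by rw [h.map_eq]; exact hi.aestronglyMeasurable)
    _ = _ := integral_prod _ hi'

end Resampling

/-! ### The lower bound for the first absolute moment. -/

/-- The odd function equal to `w / τ` on `[-τ, τ]` and constant on both sides of it. -/
noncomputable def clip (τ w : ℝ) : ℝ := max (-1) (min 1 (w / τ))

theorem abs_clip_le (τ w : ℝ) : |clip τ w| ≤ 1 := by
  unfold clip
  rw [abs_le]
  exact ⟨le_max_left _ _, max_le (by norm_num) (min_le_left _ _)⟩

theorem measurable_clip (τ : ℝ) : Measurable (clip τ) := by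
  unfold clip
  fun_prop

theorem clip_mono {τ : ℝ} (hτ : 0 < τ) : Monotone (clip τ) := fun a b hab => by
  unfold clip
  gcongr

theorem mul_clip_sub_nonneg {τ : ℝ} (hτ : 0 < τ) (w y : ℝ) :
    0 ≤ y * (clip τ (w + y) - clip τ w) := by
  rcases le_total 0 y with hy | hy
  · exact mul_nonneg hy (sub_nonneg.2 (clip_mono hτ (by linarith)))
  · exact mul_nonneg_of_nonpos_of_nonpos hy (sub_nonpos.2 (clip_mono hτ (by linarith)))

theorem clip_neg {τ : ℝ} (w : ℝ) : clip τ (-w) = -clip τ w := by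
  unfold clip
  rw [neg_div]
  rcases le_total (w / τ) (-1) with h | h
  · rw [min_eq_left (by linarith), min_eq_right (by linarith), max_eq_right (by norm_num),
      max_eq_left h, neg_neg]
  · rcases le_total (w / τ) 1 with h' | h'
    · rw [min_eq_right (by linarith), min_eq_right h', max_eq_right (by linarith), max_eq_right h]
    · rw [min_eq_right (by linarith), min_eq_left h', max_eq_left (by linarith),
        max_eq_right (by norm_num)]

theorem min_le_clip_sub {τ : ℝ} (hτ : 0 < τ) {w y : ℝ} (hw : |w| ≤ τ / 2) (hy : 0 ≤ y) :
    min (y / τ) (1 / 2) ≤ clip τ (w + y) - clip τ w := by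
  obtain ⟨h1, h2⟩ := abs_le.1 hw
  have hw1 : -(1 / 2) ≤ w / τ := by rw [le_div_iff₀ hτ]; linarith
  have hw2 : w / τ ≤ 1 / 2 := by rw [div_le_iff₀ hτ]; linarith
  have hy' : 0 ≤ y / τ := by positivity
  have hcw : clip τ w = w / τ := by
    unfold clip
    rw [min_eq_right (by linarith), max_eq_right (by linarith)]
  rw [hcw]
  unfold clip
  rw [add_div]
  rcases le_total 1 (w / τ + y / τ) with h | h
  · rw [min_eq_left h, max_eq_right (by norm_num)]
    exact (min_le_right _ _).trans (by linarith)
  · rw [min_eq_right h, max_eq_right (by linarith)]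
    exact (min_le_left _ _).trans (by linarith)

/-- For `|w| ≤ τ/2` the clip is still linear at `w`, so a step `y` moves it by at least `min (|y|/τ)
(1/2)`; otherwise the last factor on the left is nonpositive and monotonicity suffices. That factor
is a polynomial minorant of the indicator of `|w| ≤ τ/2`, so that only the second moment of `w` is
needed later. -/
theorem le_mul_clip_sub {τ : ℝ} (hτ : 0 < τ) (w y : ℝ) :
    min (y ^ 2 / τ) (|y| / 2) * (1 - 4 * w ^ 2 / τ ^ 2) ≤ y * (clip τ (w + y) - clip τ w) := by
  have hm : 0 ≤ min (y ^ 2 / τ) (|y| / 2) := by positivity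
  rcases le_or_gt |w| (τ / 2) with hw | hw
  · have h1 : 1 - 4 * w ^ 2 / τ ^ 2 ≤ 1 := by
      have : 0 ≤ 4 * w ^ 2 / τ ^ 2 := by positivity
      linarith
    refine (mul_le_of_le_one_right hm h1).trans ?_
    rcases le_total 0 y with hy | hy
    · have := mul_le_mul_of_nonneg_left (min_le_clip_sub hτ hw hy) hy
      rw [mul_min_of_nonneg _ _ hy] at this
      refine le_trans (le_of_eq ?_) this
      rw [abs_of_nonneg hy]
      congr 1 <;> ring
    · have hw' : |-w| ≤ τ / 2 := by rwa [abs_neg]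
      have hy' : 0 ≤ -y := by linarith
      have := mul_le_mul_of_nonneg_left (min_le_clip_sub hτ hw' hy') hy'
      rw [mul_min_of_nonneg _ _ hy', ← neg_add, clip_neg, clip_neg] at this
      refine le_trans (le_of_eq ?_) (this.trans (le_of_eq (by ring)))
      rw [abs_of_nonpos hy]
      congr 1 <;> ring
  · refine le_trans (mul_nonpos_of_nonneg_of_nonpos hm ?_) (mul_clip_sub_nonneg hτ w y)
    rw [sub_nonpos, le_div_iff₀ (by positivity), one_mul]
    have : (τ / 2) ^ 2 ≤ |w| ^ 2 := by gcongr
    rw [sq_abs] at this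
    linarith

namespace SparseMoments

variable {ν : Measure ℝ} {θ : ℝ} {n : ℕ}

theorem memLp_two (h : SparseMoments ν θ) : MemLp (fun x : ℝ => x) 2 ν :=
  (memLp_two_iff_integrable_sq (by fun_prop)).2 h.integrable_sq

variable [IsProbabilityMeasure ν]

theorem integrable_id (h : SparseMoments ν θ) : Integrable (fun x : ℝ => x) ν :=
  h.memLp_two.integrable (by norm_num)

theorem integrable_eval (h : SparseMoments ν θ) (k : Fin n) :
    Integrable (fun x : Fin n → ℝ => x k) (Measure.pi fun _ => ν) :=
  (measurePreserving_eval (fun _ : Fin n => ν) k).integrable_comp_of_integrable h.integrable_id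

theorem integrable_dotProduct (h : SparseMoments ν θ) (v : Fin n → ℝ) :
    Integrable (fun x : Fin n → ℝ => v ⬝ᵥ x) (Measure.pi fun _ => ν) :=
  integrable_finsetSum _ fun k _ => (h.integrable_eval k).const_mul (v k)

theorem integral_dotProduct_sq_le (h : SparseMoments ν θ) (hθ : 0 ≤ θ) (c : Fin n → ℝ)
    (hc : ∀ k, |c k| ≤ 1) :
    Integrable (fun x : Fin n → ℝ => (c ⬝ᵥ x) ^ 2) (Measure.pi fun _ => ν) ∧
      ∫ x, (c ⬝ᵥ x) ^ 2 ∂(Measure.pi fun _ : Fin n => ν) ≤ 6 * θ * n := by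
  have hmem : ∀ k : Fin n, MemLp (fun y : ℝ => c k * y) 2 ν := fun k => h.memLp_two.const_mul (c k)
  have hmean : ∫ x, c ⬝ᵥ x ∂(Measure.pi fun _ : Fin n => ν) = 0 := by
    simp only [dotProduct]
    rw [integral_finsetSum _ fun k _ => (h.integrable_eval k).const_mul (c k)]
    refine Finset.sum_eq_zero fun k _ => ?_
    rw [integral_const_mul, integral_comp_eval (μ := fun _ : Fin n => ν) (f := fun y : ℝ => y)
      (by fun_prop), h.mean, mul_zero]
  have hmemsum : MemLp (fun x : Fin n → ℝ => c ⬝ᵥ x) 2 (Measure.pi fun _ => ν) :=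
    memLp_finsetSum _ fun k _ =>
      (hmem k).comp_measurePreserving (measurePreserving_eval (fun _ : Fin n => ν) k)
  refine ⟨hmemsum.integrable_sq, ?_⟩
  have hvar := variance_sum_pi hmem
  have heq : (∑ i, fun ω : Fin n → ℝ => c i * ω i) = fun x => c ⬝ᵥ x := by
    ext x; simp [dotProduct]
  rw [heq, variance_of_integral_eq_zero hmemsum.aestronglyMeasurable.aemeasurable hmean] at hvar
  rw [hvar]
  calc _ ≤ ∑ k : Fin n, 6 * θ := by
        refine Finset.sum_le_sum fun k _ => ?_
        refine (variance_le_expectation_sq (hmem k).aestronglyMeasurable).trans ?_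
        simp only [Pi.pow_apply, mul_pow]
        rw [integral_const_mul]
        have h1 : c k ^ 2 ≤ 1 := by rw [← sq_abs]; exact pow_le_one₀ (abs_nonneg _) (hc k)
        have h2 : 0 ≤ ∫ x, x ^ 2 ∂ν := integral_nonneg fun x => sq_nonneg x
        nlinarith [h.sq_le]
    _ = 6 * θ * n := by simp; ring

/-- The integrand dominates `(|y|/20 - 1/1600)/τ` for `y ≠ 0`, by expanding `(|y| - 1/40)² ≥ 0`. The
constant is only paid on `y ≠ 0`, which has mass at most `θ`, so the bound keeps the order `θ`. -/
theorem le_integral_min (h : SparseMoments ν θ) {τ : ℝ} (hτ : 1 ≤ τ) :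
    Integrable (fun y : ℝ => min (y ^ 2 / τ) (|y| / 2)) ν ∧
      θ / (400 * τ) ≤ ∫ y, min (y ^ 2 / τ) (|y| / 2) ∂ν := by
  have hτ0 : 0 < τ := by linarith
  have hm : MeasurableSet {x : ℝ | x ≠ 0} := (measurableSet_singleton 0).compl
  have hint : Integrable (fun y : ℝ => min (y ^ 2 / τ) (|y| / 2)) ν :=
    (h.integrable_sq.div_const τ).inf (h.integrable_id.abs.div_const 2)
  refine ⟨hint, ?_⟩
  have hind : Integrable (fun y : ℝ => Set.indicator {x : ℝ | x ≠ 0} (fun _ => (1 : ℝ)) y) ν :=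
    (integrable_const 1).indicator hm
  calc θ / (400 * τ) ≤ (1 / τ) * ((∫ y, |y| ∂ν) / 20 -
        (1 / 1600) * ∫ y, Set.indicator {x : ℝ | x ≠ 0} (fun _ => (1 : ℝ)) y ∂ν) := by
        rw [integral_indicator_const _ hm, smul_eq_mul, mul_one]
        have h1 := h.le_abs
        have h2 := h.nonzero_le
        have h3 : 0 ≤ ν.real {x | x ≠ 0} := measureReal_nonneg
        rw [show θ / (400 * τ) = (1 / τ) * (θ / 400) by field_simp]
        gcongr
        linarith
    _ = ∫ y, (1 / τ) * (|y| / 20 -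
        (1 / 1600) * Set.indicator {x : ℝ | x ≠ 0} (fun _ => (1 : ℝ)) y) ∂ν := by
        rw [integral_const_mul, integral_sub (h.integrable_id.abs.div_const 20)
          (hind.const_mul _), integral_const_mul, integral_div]
    _ ≤ _ := by
        refine integral_mono (((h.integrable_id.abs.div_const 20).sub
          (hind.const_mul _)).const_mul _) hint fun y => ?_
        by_cases hy : y = 0
        · simp [hy]
        · have hy0 : 0 < |y| := abs_pos.2 hy
          simp only [Set.indicator_of_mem (show y ∈ {x : ℝ | x ≠ 0} from hy)]
          rw [le_min_iff, one_div_mul_eq_div, ← sq_abs]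
          refine ⟨?_, ?_⟩
          · gcongr
            nlinarith [sq_nonneg (|y| - 1 / 40)]
          · rw [div_le_iff₀ hτ0]
            nlinarith

/-- As `y` is centered, `clip τ w` may be subtracted for free, and the pointwise bound for the
increment applies. -/
theorem le_integral_mul_clip (h : SparseMoments ν θ) {τ : ℝ} (hτ : 1 ≤ τ) (w s : ℝ)
    (hs : s ^ 2 = 1) :
    (∫ y, min (y ^ 2 / τ) (|y| / 2) ∂ν) * (1 - 4 * w ^ 2 / τ ^ 2) ≤
      s * ∫ y, y * clip τ (w + s * y) ∂ν := by
  have hτ0 : 0 < τ := by linarith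
  have hint := (h.le_integral_min hτ).1
  have hmeas : Measurable fun y : ℝ => clip τ (w + s * y) :=
    (measurable_clip τ).comp (by fun_prop)
  have hcint : Integrable (fun y : ℝ => y * clip τ (w + s * y)) ν :=
    h.integrable_id.mul_bdd (c := 1) hmeas.aestronglyMeasurable
      (Filter.Eventually.of_forall fun y => abs_clip_le _ _)
  have hmul : s * ∫ y, y * clip τ (w + s * y) ∂ν =
      ∫ y, (s * y) * (clip τ (w + s * y) - clip τ w) ∂ν := by
    have : ∀ y, (s * y) * (clip τ (w + s * y) - clip τ w) =
        s * (y * clip τ (w + s * y)) - (s * clip τ w) * y := fun y => by ring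
    simp only [this]
    rw [integral_sub (hcint.const_mul s) (h.integrable_id.const_mul _), integral_const_mul,
      integral_const_mul, h.mean, mul_zero, sub_zero]
  have hsabs : |s| = 1 := by
    rw [← sq_abs] at hs
    nlinarith [abs_nonneg s]
  have hrint : Integrable (fun y => (s * y) * (clip τ (w + s * y) - clip τ w)) ν := by
    have : ∀ y, (s * y) * (clip τ (w + s * y) - clip τ w) =
        s * (y * clip τ (w + s * y)) - (s * clip τ w) * y := fun y => by ring
    simp only [this]
    exact (hcint.const_mul s).sub (h.integrable_id.const_mul _)
  rw [hmul]
  calc _ = ∫ y, min (y ^ 2 / τ) (|y| / 2) * (1 - 4 * w ^ 2 / τ ^ 2) ∂ν :=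
        (integral_mul_const _ _).symm
    _ ≤ _ := by
        refine integral_mono (hint.mul_const _) hrint fun y => ?_
        have := le_mul_clip_sub hτ0 w (s * y)
        rwa [mul_pow, hs, one_mul, abs_mul, hsabs, one_mul] at this

/-- Resample coordinate `k`: the other coordinates enter only through `w = c ⬝ᵥ x`, whose second
moment is at most `6θn`. The hypothesis on `τ` makes `4 E w² / τ² ≤ 1/2`, so half of the
one-dimensional bound survives. -/
theorem le_integral_mul_clip_dotProduct (h : SparseMoments ν θ) (hθ : 0 ≤ θ) {τ : ℝ} (hτ : 1 ≤ τ)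
    (hτθ : 48 * (θ * n) ≤ τ ^ 2) (s : Fin n → ℝ) (hs : ∀ k, s k ^ 2 = 1) (k : Fin n) :
    θ / (800 * τ) ≤
      s k * ∫ x, x k * clip τ (s ⬝ᵥ x) ∂(Measure.pi fun _ : Fin n => ν) := by
  have hτ0 : 0 < τ := by linarith
  set π := Measure.pi fun _ : Fin n => ν with hπ
  set c := Function.update s k 0 with hc
  set M := ∫ y, min (y ^ 2 / τ) (|y| / 2) ∂ν with hM
  have hc1 : ∀ j, |c j| ≤ 1 := fun j => by
    by_cases hj : j = k
    · subst hj; simp [hc]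
    · rw [hc, Function.update_of_ne hj, ← sq_le_one_iff_abs_le_one, hs j]
  obtain ⟨hcint, hcle⟩ := h.integral_dotProduct_sq_le hθ c hc1
  have hdecomp : ∀ (x : Fin n → ℝ) (y : ℝ),
      s ⬝ᵥ Function.update x k y = c ⬝ᵥ x + s k * y := fun x y => by
    simp only [dotProduct, hc]
    rw [← Finset.add_sum_erase Finset.univ _ (Finset.mem_univ k),
      ← Finset.add_sum_erase Finset.univ (fun i => Function.update s k 0 i * x i)
        (Finset.mem_univ k)]
    simp only [Function.update_self, zero_mul, zero_add]
    rw [add_comm]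
    congr 1
    refine Finset.sum_congr rfl fun j hj => ?_
    rw [Function.update_of_ne (Finset.ne_of_mem_erase hj),
      Function.update_of_ne (Finset.ne_of_mem_erase hj)]
  have hmeas : Measurable fun x : Fin n → ℝ => clip τ (s ⬝ᵥ x) :=
    (measurable_clip τ).comp (by unfold dotProduct; fun_prop)
  have hfint : Integrable (fun x : Fin n → ℝ => x k * clip τ (s ⬝ᵥ x)) π :=
    (h.integrable_eval k).mul_bdd (c := 1) hmeas.aestronglyMeasurable
      (Filter.Eventually.of_forall fun y => abs_clip_le _ _)
  have hinner : Integrable (fun x => ∫ y, y * clip τ (c ⬝ᵥ x + s k * y) ∂ν) π := by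
    have := ((measurePreserving_update_pi (fun _ : Fin n => ν) k).integrable_comp_of_integrable
      hfint).integral_prod_left
    simpa [hdecomp] using this
  have hle := (h.le_integral_min hτ).2
  rw [integral_pi_eq_integral_update (fun _ : Fin n => ν) k hfint, ← integral_const_mul]
  simp only [Function.update_self, hdecomp]
  calc θ / (800 * τ) ≤ M * (1 - 4 / τ ^ 2 * ∫ x, (c ⬝ᵥ x) ^ 2 ∂π) := by
        have h1 : 4 / τ ^ 2 * ∫ x, (c ⬝ᵥ x) ^ 2 ∂π ≤ 1 / 2 := by
          rw [div_mul_eq_mul_div, div_le_iff₀ (by positivity)]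
          linarith
        have h2 : θ / (800 * τ) = θ / (400 * τ) * (1 / 2) := by field_simp; ring
        rw [h2]
        have h3 : 0 ≤ θ / (400 * τ) := by positivity
        exact mul_le_mul hle (by linarith) (by norm_num) (h3.trans hle)
    _ = ∫ x, (M - 4 * M / τ ^ 2 * (c ⬝ᵥ x) ^ 2) ∂π := by
        rw [integral_sub (integrable_const _) (hcint.const_mul _), integral_const_mul]
        simp only [integral_const, probReal_univ, one_smul]
        ring
    _ ≤ _ := by
        refine integral_mono ((integrable_const _).sub (hcint.const_mul _))
          (hinner.const_mul _) fun x => ?_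
        refine le_trans (le_of_eq ?_) (h.le_integral_mul_clip hτ (c ⬝ᵥ x) (s k) (hs k))
        ring

/-- The lower bound for the first absolute moment of a linear functional of a sparse vector. -/
theorem le_integral_abs_dotProduct (h : SparseMoments ν θ) (hθn : 2 ≤ θ * n) (v : Fin n → ℝ) :
    θ / (5600 * √(θ * n)) * l1Norm v ≤ ∫ x, |v ⬝ᵥ x| ∂(Measure.pi fun _ : Fin n => ν) := by
  have hθ : 0 ≤ θ := by
    by_contra hneg
    push Not at hneg
    nlinarith [(Nat.cast_nonneg n : (0 : ℝ) ≤ n)]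
  set q := √(θ * n) with hq
  have hq2 : q ^ 2 = θ * n := Real.sq_sqrt (by linarith)
  have hq1 : 1 ≤ q := by
    rw [hq, Real.one_le_sqrt]; linarith
  -- With `s` the sign pattern of `v`, the inequality `|v ⬝ᵥ x| ≥ (v ⬝ᵥ x) * clip τ (s ⬝ᵥ x)` has a
  -- right side that splits over coordinates, each with a nonnegative contribution. The choice `τ =
  -- 7q` is admissible because `49 ≥ 48`.
  set s : Fin n → ℝ := fun k => if v k < 0 then -1 else 1 with hs
  have hs2 : ∀ k, s k ^ 2 = 1 := fun k => by
    simp only [hs]; split_ifs <;> norm_num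
  have hsv : ∀ k, v k = |v k| * s k := fun k => by
    simp only [hs]
    split_ifs with hk
    · rw [abs_of_neg hk]; ring
    · rw [abs_of_nonneg (not_lt.1 hk), mul_one]
  have hmeas : Measurable fun x : Fin n → ℝ => clip (7 * q) (s ⬝ᵥ x) :=
    (measurable_clip _).comp (by unfold dotProduct; fun_prop)
  have hfint : ∀ k, Integrable (fun x : Fin n → ℝ => x k * clip (7 * q) (s ⬝ᵥ x))
      (Measure.pi fun _ : Fin n => ν) := fun k =>
    (h.integrable_eval k).mul_bdd (c := 1) hmeas.aestronglyMeasurable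
      (Filter.Eventually.of_forall fun y => abs_clip_le _ _)
  calc _ = ∑ k, |v k| * (θ / (800 * (7 * q))) := by
        rw [l1Norm, Finset.mul_sum]
        refine Finset.sum_congr rfl fun k _ => ?_
        ring
    _ ≤ ∑ k, |v k| * (s k * ∫ x, x k * clip (7 * q) (s ⬝ᵥ x)
          ∂(Measure.pi fun _ : Fin n => ν)) := by
        gcongr with k
        exact h.le_integral_mul_clip_dotProduct hθ (by linarith) (by rw [mul_pow, hq2]; linarith)
          s hs2 k
    _ = ∫ x, (v ⬝ᵥ x) * clip (7 * q) (s ⬝ᵥ x) ∂(Measure.pi fun _ : Fin n => ν) := by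
        have : ∀ x : Fin n → ℝ, (v ⬝ᵥ x) * clip (7 * q) (s ⬝ᵥ x) =
            ∑ k, v k * (x k * clip (7 * q) (s ⬝ᵥ x)) := fun x => by
          rw [dotProduct, Finset.sum_mul]
          exact Finset.sum_congr rfl fun k _ => by ring
        simp only [this]
        rw [integral_finsetSum _ fun k _ => (hfint k).const_mul (v k)]
        refine Finset.sum_congr rfl fun k _ => ?_
        rw [integral_const_mul, ← mul_assoc, ← hsv]
    _ ≤ _ := by
        refine integral_mono ((h.integrable_dotProduct v).mul_bdd (c := 1)
          hmeas.aestronglyMeasurable (Filter.Eventually.of_forall fun y => abs_clip_le _ _))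
          (h.integrable_dotProduct v).abs fun x => ?_
        refine (le_abs_self _).trans ?_
        rw [abs_mul]
        exact mul_le_of_le_one_right (abs_nonneg _) (abs_clip_le _ _)

end SparseMoments

/-! ### The signed mean of a linear functional. -/

open Classical in
/-- The sign `1` if `x` vanishes on `I`, and `-1` otherwise. -/
noncomputable def vanishSign {n : ℕ} (I : Set (Fin n)) (x : Fin n → ℝ) : ℝ :=
  if ∀ k ∈ I, x k = 0 then 1 else -1

theorem vanishSign_eq_or {n : ℕ} (I : Set (Fin n)) (x : Fin n → ℝ) :
    vanishSign I x = 1 ∨ vanishSign I x = -1 := by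
  unfold vanishSign
  split_ifs <;> simp

theorem measurable_vanishSign {n : ℕ} (I : Set (Fin n)) : Measurable (vanishSign I) := by
  unfold vanishSign
  refine Measurable.ite ?_ measurable_const measurable_const
  have : {x : Fin n → ℝ | ∀ k ∈ I, x k = 0} = ⋂ k ∈ I, {x | x k = 0} := by ext; simp
  rw [this]
  exact MeasurableSet.biInter (Set.to_countable _) fun k _ =>
    measurableSet_eq_fun (measurable_pi_apply k) measurable_const

namespace SparseMoments

variable {ν : Measure ℝ} [IsProbabilityMeasure ν] {θ : ℝ} {n : ℕ}

theorem integrable_vanishSign_mul (h : SparseMoments ν θ) (I : Set (Fin n)) (v : Fin n → ℝ) :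
    Integrable (fun x => vanishSign I x * |v ⬝ᵥ x|) (Measure.pi fun _ : Fin n => ν) := by
  refine (h.integrable_dotProduct v).abs.bdd_mul (c := 1)
    (measurable_vanishSign I).aestronglyMeasurable (Filter.Eventually.of_forall fun x => ?_)
  rcases vanishSign_eq_or I x with hx | hx <;> simp [hx]

/-- The sign is at least `1 - 2 ∑_{k ∈ I} 1{x k ≠ 0}`. Since `v` vanishes on `I`, each indicator is
independent of `v ⬝ᵥ x` and costs a fraction at most `θ`; in total `1 - 2/8 = 3/4` remains. -/
theorem integral_vanishSign_mul (h : SparseMoments ν θ) (I : Finset (Fin n))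
    (hI : θ * I.card ≤ 1 / 8) (v : Fin n → ℝ) (hv : ∀ k ∈ I, v k = 0) :
    3 / 4 * ∫ x, |v ⬝ᵥ x| ∂(Measure.pi fun _ : Fin n => ν) ≤
      ∫ x, vanishSign I x * |v ⬝ᵥ x| ∂(Measure.pi fun _ : Fin n => ν) := by
  set D := ∫ x, |v ⬝ᵥ x| ∂(Measure.pi fun _ : Fin n => ν) with hD
  have hD0 : 0 ≤ D := integral_nonneg fun x => abs_nonneg _
  have hm : MeasurableSet {x : ℝ | x ≠ 0} := (measurableSet_singleton 0).compl
  set g : ℝ → ℝ := Set.indicator {x : ℝ | x ≠ 0} fun _ => 1 with hg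
  have hgm : Measurable g := measurable_const.indicator hm
  have hg1 : ∀ y, ‖g y‖ ≤ 1 := fun y => by
    by_cases hy : y = 0 <;> simp [hg, hy]
  have hint : ∀ k, Integrable (fun x : Fin n → ℝ => g (x k) * |v ⬝ᵥ x|)
      (Measure.pi fun _ : Fin n => ν) := fun k =>
    (h.integrable_dotProduct v).abs.bdd_mul (c := 1)
      (hgm.comp (measurable_pi_apply k)).aestronglyMeasurable
      (Filter.Eventually.of_forall fun x => hg1 _)
  have hk : ∀ k ∈ I, ∫ x, g (x k) * |v ⬝ᵥ x| ∂(Measure.pi fun _ : Fin n => ν) ≤ θ * D := by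
    intro k hk
    have hupd : ∀ (x : Fin n → ℝ) (y : ℝ), v ⬝ᵥ Function.update x k y = v ⬝ᵥ x := fun x y => by
      refine Finset.sum_congr rfl fun j _ => ?_
      by_cases hj : j = k
      · subst hj; simp [hv j hk]
      · rw [Function.update_of_ne hj]
    rw [integral_pi_eq_integral_update (fun _ : Fin n => ν) k (hint k)]
    simp only [Function.update_self, hupd]
    simp_rw [integral_mul_const]
    rw [integral_const_mul, hg, integral_indicator_const _ hm, smul_eq_mul, mul_one]
    exact mul_le_mul_of_nonneg_right h.nonzero_le hD0
  have hpt : ∀ x : Fin n → ℝ,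
      |v ⬝ᵥ x| - 2 * ∑ k ∈ I, g (x k) * |v ⬝ᵥ x| ≤ vanishSign I x * |v ⬝ᵥ x| := fun x => by
    have habs := abs_nonneg (v ⬝ᵥ x)
    have hnn : ∀ k ∈ I, 0 ≤ g (x k) * |v ⬝ᵥ x| := fun k _ =>
      mul_nonneg (Set.indicator_nonneg (fun _ _ => zero_le_one) _) habs
    unfold vanishSign
    split_ifs with hx
    · have := Finset.sum_nonneg hnn
      linarith
    · push Not at hx
      obtain ⟨k, hkI, hkx⟩ := hx
      have h1 := Finset.single_le_sum hnn hkI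
      have h2 : g (x k) = 1 := by simp [hg, hkx]
      rw [h2] at h1
      linarith
  have hsumint : Integrable (fun x : Fin n → ℝ => ∑ k ∈ I, g (x k) * |v ⬝ᵥ x|)
      (Measure.pi fun _ : Fin n => ν) := integrable_finsetSum _ fun k _ => hint k
  calc 3 / 4 * D ≤ D - 2 * ∑ k ∈ I, θ * D := by
        rw [Finset.sum_const, nsmul_eq_mul]
        nlinarith
    _ ≤ D - 2 * ∑ k ∈ I, ∫ x, g (x k) * |v ⬝ᵥ x| ∂(Measure.pi fun _ : Fin n => ν) := by
        gcongr with k hkI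
        exact hk k hkI
    _ = ∫ x, (|v ⬝ᵥ x| - 2 * ∑ k ∈ I, g (x k) * |v ⬝ᵥ x|)
          ∂(Measure.pi fun _ : Fin n => ν) := by
        rw [integral_sub (h.integrable_dotProduct v).abs (hsumint.const_mul 2),
          integral_const_mul, integral_finsetSum _ fun k _ => hint k]
    _ ≤ _ := integral_mono ((h.integrable_dotProduct v).abs.sub (hsumint.const_mul 2))
        (h.integrable_vanishSign_mul I v) hpt

end SparseMoments

/-! ### Exponential moments of suprema: symmetrization and contraction. -/

/-- The real exponential function with values in the extended nonnegative reals. -/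
noncomputable def expENN (t : ℝ) : ENNReal := ENNReal.ofReal (Real.exp t)

@[fun_prop]
theorem measurable_expENN : Measurable expENN := by
  unfold expENN
  fun_prop

theorem expENN_mono : Monotone expENN := fun _ _ h =>
  ENNReal.ofReal_le_ofReal (Real.exp_le_exp.2 h)

theorem expENN_add (s t : ℝ) : expENN (s + t) = expENN s * expENN t := by
  unfold expENN
  rw [Real.exp_add, ENNReal.ofReal_mul (Real.exp_pos s).le]

theorem expENN_zero : expENN 0 = 1 := by simp [expENN]

theorem expENN_add_expENN_neg (t : ℝ) :
    expENN t + expENN (-t) = 2 * ENNReal.ofReal (Real.cosh t) := by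
  unfold expENN
  rw [← ENNReal.ofReal_add (Real.exp_pos _).le (Real.exp_pos _).le,
    show (2 : ENNReal) = ENNReal.ofReal 2 by simp, ← ENNReal.ofReal_mul two_pos.le,
    Real.cosh_eq]
  congr 1
  ring

theorem expENN_add_le (s t : ℝ) : 2 * expENN (s + t) ≤ expENN (2 * s) + expENN (2 * t) := by
  unfold expENN
  rw [← ENNReal.ofReal_add (Real.exp_pos _).le (Real.exp_pos _).le,
    show (2 : ENNReal) = ENNReal.ofReal 2 by simp, ← ENNReal.ofReal_mul two_pos.le]
  refine ENNReal.ofReal_le_ofReal ?_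
  rw [Real.exp_add, two_mul s, two_mul t, Real.exp_add, Real.exp_add]
  nlinarith [sq_nonneg (Real.exp s - Real.exp t)]

/-- Jensen's inequality for the exponential function. -/
theorem expENN_integral_le {α : Type*} [MeasurableSpace α] {μ : Measure α} [IsProbabilityMeasure μ]
    {f : α → ℝ} (hf : Integrable f μ) : expENN (∫ x, f x ∂μ) ≤ ∫⁻ x, expENN (f x) ∂μ := by
  by_cases h : Integrable (fun x => Real.exp (f x)) μ
  · unfold expENN
    rw [← ofReal_integral_eq_lintegral_ofReal h
      (Filter.Eventually.of_forall fun x => (Real.exp_pos _).le)]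
    exact ENNReal.ofReal_le_ofReal (convexOn_exp.map_integral_le Real.continuous_exp.continuousOn
      isClosed_univ (by simp) hf h)
  · have : ∫⁻ x, expENN (f x) ∂μ = ⊤ := by
      by_contra hne
      refine h ⟨Real.measurable_exp.comp_aemeasurable hf.aemeasurable |>.aestronglyMeasurable, ?_⟩
      rw [hasFiniteIntegral_iff_ofReal (Filter.Eventually.of_forall fun x => (Real.exp_pos _).le)]
      exact lt_top_iff_ne_top.2 hne
    rw [this]
    exact le_top

/-- The contraction principle for `|·|` with one random sign. For indices `i`, `j` on the left, the
sign of `ψ i` decides which supremum on the right receives `i`; the other one receives `j`, since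
`-|ψ j|` is below both `ψ j` and `-ψ j`. -/
theorem iSup_expENN_abs_le {ι : Type*} (h ψ : ι → ℝ) :
    (⨆ i, expENN (h i + |ψ i|)) + (⨆ i, expENN (h i - |ψ i|)) ≤
      (⨆ i, expENN (h i + ψ i)) + ⨆ i, expENN (h i - ψ i) := by
  rcases isEmpty_or_nonempty ι with hι | hι
  · simp
  refine ENNReal.iSup_add_iSup_le fun i j => ?_
  have hplus := fun i => le_iSup (fun i => expENN (h i + ψ i)) i
  have hminus := fun i => le_iSup (fun i => expENN (h i - ψ i)) i
  rcases le_total 0 (ψ i) with hi | hi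
  · rw [abs_of_nonneg hi]
    refine add_le_add (hplus i) (le_trans (expENN_mono ?_) (hminus j))
    linarith [le_abs_self (ψ j)]
  · rw [abs_of_nonpos hi, add_comm]
    refine add_le_add (le_trans (expENN_mono ?_) (hplus j))
      (le_trans (expENN_mono ?_) (hminus i))
    · linarith [neg_abs_le (ψ j)]
    · linarith

/-- Symmetrization and contraction for the exponential moment of the supremum, for a single random
summand. -/
theorem lintegral_iSup_expENN_le {α ι : Type*} [MeasurableSpace α] [Countable ι]
    {μ : Measure α} [IsProbabilityMeasure μ] (h : ι → ℝ) {ψ : ι → α → ℝ} {a : α → ℝ}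
    (ha : ∀ x, a x = 1 ∨ a x = -1) (ham : Measurable a) (hψ : ∀ i, Measurable (ψ i))
    (hint : ∀ i, Integrable (fun x => a x * |ψ i x|) μ) :
    ∫⁻ y, ⨆ i, expENN (h i + ((∫ x, a x * |ψ i x| ∂μ) - a y * |ψ i y|)) ∂μ ≤
      ∫⁻ y, ((⨆ i, expENN (h i + 2 * ψ i y)) + ⨆ i, expENN (h i - 2 * ψ i y)) / 2 ∂μ := by
  set Z : ι → α → ℝ := fun i x => a x * |ψ i x| with hZ
  have hZm : ∀ i, Measurable (Z i) := fun i => ham.mul (hψ i).abs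
  set A : α → ENNReal := fun y => ⨆ i, expENN (h i + 2 * Z i y) with hA
  set B : α → ENNReal := fun y => ⨆ i, expENN (h i - 2 * Z i y) with hB
  have hAm : Measurable A := Measurable.iSup fun i => by fun_prop
  have hBm : Measurable B := Measurable.iSup fun i => by fun_prop
  -- Jensen turns the mean into an independent copy `y'`. Then `2 exp (s + t) ≤ exp (2s) + exp (2t)`
  -- separates the two copies, which is where the factor `2` in front of `ψ` comes from.
  calc _ ≤ ∫⁻ y, ∫⁻ y', (A y' + B y) / 2 ∂μ ∂μ := by
        refine lintegral_mono fun y => iSup_le fun i => ?_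
        have hi : h i + ((∫ x, Z i x ∂μ) - Z i y) = ∫ x, (Z i x + (h i - Z i y)) ∂μ := by
          rw [integral_add (hint i) (integrable_const _)]
          simp only [integral_const, probReal_univ, one_smul]
          ring
        simp only [hZ] at hi ⊢
        rw [hi]
        refine (expENN_integral_le ((hint i).add (integrable_const _))).trans
          (lintegral_mono fun y' => ?_)
        rw [ENNReal.le_div_iff_mul_le (by simp) (by simp), mul_comm]
        have hs : a y' * |ψ i y'| + (h i - a y * |ψ i y|) =
            (h i / 2 + Z i y') + (h i / 2 - Z i y) := by simp only [hZ]; ring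
        change 2 * expENN (a y' * |ψ i y'| + (h i - a y * |ψ i y|)) ≤ _
        rw [hs]
        refine (expENN_add_le _ _).trans (add_le_add ?_ ?_)
        · refine le_trans (le_of_eq ?_) (le_iSup _ i)
          congr 1; ring
        · refine le_trans (le_of_eq ?_) (le_iSup _ i)
          congr 1; ring
    _ = ∫⁻ y, (A y + B y) / 2 ∂μ := by
        simp only [div_eq_mul_inv]
        have h1 : ∀ y, ∫⁻ y', (A y' + B y) * 2⁻¹ ∂μ = (∫⁻ y', A y' ∂μ + B y) * 2⁻¹ := fun y => by
          rw [lintegral_mul_const _ (by fun_prop), lintegral_add_left hAm]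
          simp
        simp only [h1]
        rw [lintegral_mul_const _ (by fun_prop), lintegral_mul_const _ (by fun_prop),
          lintegral_add_left (by fun_prop), lintegral_add_left hAm]
        simp
    _ ≤ _ := by
        refine lintegral_mono fun y => ENNReal.div_le_div_right ?_ 2
        have hc := iSup_expENN_abs_le h fun i => 2 * ψ i y
        simp only [abs_mul, abs_two] at hc
        refine le_trans ?_ hc
        simp only [hA, hB, hZ]
        -- The sign `a y` only decides which of the two suprema is which, and their sum is
        -- symmetric.
        rcases ha y with hy | hy
        · simp only [hy, one_mul, le_refl]
        · rw [add_comm]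
          simp only [hy, neg_mul, one_mul, mul_neg, sub_neg_eq_add, ← sub_eq_add_neg, le_refl]

theorem abs_dotProduct_le {n : ℕ} (v u : Fin n → ℝ) {c : ℝ} (hu : ∀ k, |u k| ≤ c) :
    |v ⬝ᵥ u| ≤ l1Norm v * c := by
  rw [l1Norm, Finset.sum_mul]
  refine (Finset.abs_sum_le_sum_abs _ _).trans (Finset.sum_le_sum fun k _ => ?_)
  rw [abs_mul]
  exact mul_le_mul_of_nonneg_left (hu k) (abs_nonneg _)

/-- The sum of `exp (r u_k) + exp (-r u_k)` over all coordinates. -/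
noncomputable def expSum {n : ℕ} (r : ℝ) (u : Fin n → ℝ) : ENNReal :=
  ∑ k, (expENN (r * u k) + expENN (-(r * u k)))

@[fun_prop]
theorem measurable_expSum {n : ℕ} (r : ℝ) : Measurable (expSum (n := n) r) := by
  unfold expSum
  fun_prop

/-- Duality of `ℓ¹` and `ℓ^∞`, with the maximum over signed coordinates bounded by the sum. This is
the only place where the supremum over `w` costs anything. -/
theorem expENN_dotProduct_le_expSum {n : ℕ} (hn : 0 < n) {r : ℝ} {w : Fin n → ℝ}
    (hw : l1Norm w ≤ r) (u : Fin n → ℝ) : expENN (w ⬝ᵥ u) ≤ expSum r u := by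
  have : Nonempty (Fin n) := ⟨⟨0, hn⟩⟩
  obtain ⟨k, hk⟩ := Finite.exists_max fun k => |u k|
  have hle : w ⬝ᵥ u ≤ r * |u k| := (le_abs_self _).trans ((abs_dotProduct_le w u hk).trans
    (mul_le_mul_of_nonneg_right hw (abs_nonneg _)))
  calc expENN (w ⬝ᵥ u) ≤ expENN (r * |u k|) := expENN_mono hle
    _ ≤ expENN (r * u k) + expENN (-(r * u k)) := by
      rcases abs_choice (u k) with h | h
      · rw [h]; exact le_self_add
      · rw [h, mul_neg]; exact le_add_self
    _ ≤ expSum r u := Finset.single_le_sum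
      (f := fun k => expENN (r * u k) + expENN (-(r * u k))) (fun _ _ => zero_le)
      (Finset.mem_univ k)

theorem expSum_add_expSum_sub {n : ℕ} (r : ℝ) (u y : Fin n → ℝ) :
    (expSum r (u + (2 : ℝ) • y) + expSum r (u - (2 : ℝ) • y)) / 2 =
      ∑ k, (expENN (r * u k) + expENN (-(r * u k))) *
        ENNReal.ofReal (Real.cosh (2 * r * y k)) := by
  rw [expSum, expSum, ← Finset.sum_add_distrib, div_eq_mul_inv, Finset.sum_mul]
  refine Finset.sum_congr rfl fun k _ => ?_
  have e1 : r * (u + (2 : ℝ) • y) k = r * u k + 2 * r * y k := by simp; ring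
  have e2 : r * (u - (2 : ℝ) • y) k = r * u k + -(2 * r * y k) := by simp; ring
  rw [e1, e2, neg_add, neg_add, neg_neg, expENN_add, expENN_add, expENN_add, expENN_add]
  have h := expENN_add_expENN_neg (2 * r * y k)
  calc _ = (expENN (r * u k) + expENN (-(r * u k))) *
        (expENN (2 * r * y k) + expENN (-(2 * r * y k))) * 2⁻¹ := by ring
    _ = _ := by
      rw [h, mul_comm (2 : ENNReal), mul_assoc, mul_assoc, ENNReal.mul_inv_cancel (by simp)
        (by simp), mul_one]

/-- Averaging over the shifts `±2y` multiplies the `k`-th summand by `cosh (2 r y_k)`, so one column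
multiplies `expSum` by at most `K` on average. -/
theorem lintegral_expSum_le {n : ℕ} {μ : Measure (Fin n → ℝ)} {r : ℝ} {K : ENNReal}
    (hK : ∀ k, ∫⁻ y, ENNReal.ofReal (Real.cosh (2 * r * y k)) ∂μ ≤ K) (u : Fin n → ℝ) :
    ∫⁻ y, (expSum r (u + (2 : ℝ) • y) + expSum r (u - (2 : ℝ) • y)) / 2 ∂μ ≤ expSum r u * K := by
  have hm : ∀ k, Measurable fun y : Fin n → ℝ => ENNReal.ofReal (Real.cosh (2 * r * y k)) :=
    fun k => (Real.measurable_cosh.comp (by fun_prop)).ennreal_ofReal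
  simp only [expSum_add_expSum_sub]
  rw [lintegral_finsetSum _ fun k _ => (hm k).const_mul _, expSum, Finset.sum_mul]
  refine Finset.sum_le_sum fun k _ => ?_
  rw [lintegral_const_mul _ (hm k)]
  gcongr
  exact hK k

section Columns

variable {n p : ℕ} {V : Type*} {μ : Measure (Fin n → ℝ)}

/-- The exponential of the supremum of the linear functionals `w v` at `u`, perturbed by the
centered sums of `-a |w v|` over the columns in `L`. -/
noncomputable def expSupDev (μ : Measure (Fin n → ℝ)) (a : (Fin n → ℝ) → ℝ) (w : V → Fin n → ℝ)
    (L : Finset (Fin p)) (u : Fin n → ℝ) (x : Fin p → Fin n → ℝ) : ENNReal :=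
  ⨆ v, expENN (w v ⬝ᵥ u + ∑ l ∈ L, ((∫ y, a y * |w v ⬝ᵥ y| ∂μ) - a (x l) * |w v ⬝ᵥ x l|))

@[fun_prop]
theorem measurable_expSupDev [Countable V] {a : (Fin n → ℝ) → ℝ} (ha : Measurable a)
    (w : V → Fin n → ℝ) (L : Finset (Fin p)) {β : Type*} [MeasurableSpace β] {f : β → Fin n → ℝ}
    {g : β → Fin p → Fin n → ℝ} (hf : Measurable f) (hg : Measurable g) :
    Measurable fun z => expSupDev μ a w L (f z) (g z) := by
  unfold expSupDev
  refine Measurable.iSup fun v => measurable_expENN.comp (Measurable.add ?_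
    (Finset.measurable_fun_sum _ fun l _ => measurable_const.sub (Measurable.mul ?_ ?_)))
  · unfold dotProduct
    fun_prop
  · exact ha.comp ((measurable_pi_apply l).comp hg)
  · unfold dotProduct
    fun_prop

/-- Induction over the columns: resampling one of them trades its centered term for a shift of `u`
by `±2y`, which is why `u` is kept general. The weight `g` carries the conditioning event; it does
not depend on the columns in `L`, so it passes through each step. -/
theorem lintegral_expSupDev_le [Countable V] [IsProbabilityMeasure μ] (hn : 0 < n)
    {a : (Fin n → ℝ) → ℝ} (ha : ∀ x, a x = 1 ∨ a x = -1) (ham : Measurable a)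
    {w : V → Fin n → ℝ} {r : ℝ} (hw : ∀ v, l1Norm (w v) ≤ r)
    (hint : ∀ v, Integrable (fun x => a x * |w v ⬝ᵥ x|) μ) {K : ENNReal}
    (hK : ∀ k, ∫⁻ y, ENNReal.ofReal (Real.cosh (2 * r * y k)) ∂μ ≤ K)
    {g : (Fin p → Fin n → ℝ) → ENNReal} (hg : Measurable g) (L : Finset (Fin p))
    (hgL : ∀ l ∈ L, ∀ x y, g (Function.update x l y) = g x) (u : Fin n → ℝ) :
    ∫⁻ x, g x * expSupDev μ a w L u x ∂(Measure.pi fun _ : Fin p => μ) ≤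
      expSum r u * K ^ L.card * ∫⁻ x, g x ∂(Measure.pi fun _ : Fin p => μ) := by
  classical
  set π := Measure.pi fun _ : Fin p => μ with hπ
  induction L using Finset.induction_on generalizing u with
  | empty =>
    rw [Finset.card_empty, pow_zero, mul_one, ← lintegral_const_mul _ hg]
    refine lintegral_mono fun x => ?_
    rw [mul_comm]
    refine mul_le_mul_left (iSup_le fun v => ?_) _
    rw [Finset.sum_empty, add_zero]
    exact expENN_dotProduct_le_expSum hn (hw v) u
  | insert l L hl ih =>
    have ih' := ih fun j hj => hgL j (Finset.mem_insert_of_mem hj)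
    have hstep : ∀ x, ∫⁻ y, expSupDev μ a w (insert l L) u (Function.update x l y) ∂μ ≤
        ∫⁻ y, (expSupDev μ a w L (u + (2 : ℝ) • y) x +
          expSupDev μ a w L (u - (2 : ℝ) • y) x) / 2 ∂μ := fun x => by
      have := lintegral_iSup_expENN_le (μ := μ) (fun v => w v ⬝ᵥ u +
        ∑ l ∈ L, ((∫ y, a y * |w v ⬝ᵥ y| ∂μ) - a (x l) * |w v ⬝ᵥ x l|))
        (ψ := fun v y => w v ⬝ᵥ y) ha ham (fun v => by unfold dotProduct; fun_prop) hint
      refine le_trans (le_of_eq ?_) (this.trans (le_of_eq ?_))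
      · refine lintegral_congr fun y => ?_
        unfold expSupDev
        refine iSup_congr fun v => ?_
        rw [Finset.sum_insert hl, Function.update_self]
        have : ∀ j ∈ L, Function.update x l y j = x j := fun j hj =>
          Function.update_of_ne (ne_of_mem_of_not_mem hj hl) _ _
        rw [Finset.sum_congr rfl fun j hj => by rw [this j hj]]
        congr 1
        ring
      · refine lintegral_congr fun y => ?_
        unfold expSupDev
        congr 2
        · refine iSup_congr fun v => ?_
          rw [dotProduct_add, dotProduct_smul, smul_eq_mul]
          congr 1
          ring
        · refine iSup_congr fun v => ?_
          rw [dotProduct_sub, dotProduct_smul, smul_eq_mul]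
          congr 1
          ring
    have hgx : ∀ x y, g (Function.update x l y) = g x := hgL l (Finset.mem_insert_self _ _)
    calc _ = ∫⁻ x, ∫⁻ y, g x * expSupDev μ a w (insert l L) u (Function.update x l y) ∂μ ∂π := by
          rw [hπ, lintegral_pi_eq_lintegral_update (fun _ : Fin p => μ) l
            (f := fun x => g x * expSupDev μ a w (insert l L) u x) (by fun_prop)]
          simp only [hgx]
      _ ≤ ∫⁻ x, ∫⁻ y, g x * ((expSupDev μ a w L (u + (2 : ℝ) • y) x +
          expSupDev μ a w L (u - (2 : ℝ) • y) x) / 2) ∂μ ∂π := by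
          refine lintegral_mono fun x => ?_
          rw [lintegral_const_mul _ (by fun_prop), lintegral_const_mul _ (by fun_prop)]
          exact mul_le_mul_right (hstep x) _
      _ = ∫⁻ y, ∫⁻ x, g x * ((expSupDev μ a w L (u + (2 : ℝ) • y) x +
          expSupDev μ a w L (u - (2 : ℝ) • y) x) / 2) ∂π ∂μ := by
          exact lintegral_lintegral_swap (Measurable.aemeasurable (by
            unfold Function.uncurry; fun_prop))
      _ ≤ ∫⁻ y, ((expSum r (u + (2 : ℝ) • y) + expSum r (u - (2 : ℝ) • y)) / 2) *
          (K ^ L.card * ∫⁻ x, g x ∂π) ∂μ := by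
          refine lintegral_mono fun y => ?_
          have hsplit : ∀ x, g x * ((expSupDev μ a w L (u + (2 : ℝ) • y) x +
              expSupDev μ a w L (u - (2 : ℝ) • y) x) / 2) =
              (g x * expSupDev μ a w L (u + (2 : ℝ) • y) x +
                g x * expSupDev μ a w L (u - (2 : ℝ) • y) x) * 2⁻¹ := fun x => by
            rw [div_eq_mul_inv]; ring
          simp only [hsplit]
          rw [lintegral_mul_const _ (by fun_prop), lintegral_add_left (by fun_prop)]
          refine (mul_le_mul_left (add_le_add (ih' _) (ih' _)) _).trans (le_of_eq ?_)
          rw [div_eq_mul_inv]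
          ring
      _ ≤ expSum r u * K * (K ^ L.card * ∫⁻ x, g x ∂π) := by
          rw [lintegral_mul_const _ (by fun_prop)]
          exact mul_le_mul_left (lintegral_expSum_le hK u) _
      _ = _ := by
          rw [Finset.card_insert_of_notMem hl, pow_succ]
          ring

/-- The Chernoff bound for the supremum over `v` of the centered sums of `-a |w v|`. -/
theorem measure_inter_expSupDev_le [Countable V] [IsProbabilityMeasure μ] (hn : 0 < n)
    {a : (Fin n → ℝ) → ℝ} (ha : ∀ x, a x = 1 ∨ a x = -1) (ham : Measurable a)
    {w : V → Fin n → ℝ} {r : ℝ} (hw : ∀ v, l1Norm (w v) ≤ r)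
    (hint : ∀ v, Integrable (fun x => a x * |w v ⬝ᵥ x|) μ) {K : ENNReal}
    (hK : ∀ k, ∫⁻ y, ENNReal.ofReal (Real.cosh (2 * r * y k)) ∂μ ≤ K)
    {A : Set (Fin p → Fin n → ℝ)} (hA : MeasurableSet A) (L : Finset (Fin p))
    (hAL : ∀ l ∈ L, ∀ x y, Function.update x l y ∈ A ↔ x ∈ A) (t : ℝ) :
    (Measure.pi fun _ : Fin p => μ) (A ∩ {x | expENN t ≤ expSupDev μ a w L 0 x}) ≤
      2 * n * K ^ L.card * expENN (-t) * (Measure.pi fun _ : Fin p => μ) A := by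
  set π := Measure.pi fun _ : Fin p => μ with hπ
  have hm : Measurable fun x : Fin p → Fin n → ℝ => expSupDev μ a w L 0 x :=
    measurable_expSupDev ham w L measurable_const measurable_id
  have hmain := lintegral_expSupDev_le (p := p) hn ha ham hw hint hK
    (g := A.indicator 1) (measurable_one.indicator hA) L
    (fun l hl x y => by
      by_cases hx : x ∈ A
      · rw [Set.indicator_of_mem hx, Set.indicator_of_mem ((hAL l hl x y).2 hx)]; rfl
      · rw [Set.indicator_of_notMem hx, Set.indicator_of_notMem (mt (hAL l hl x y).1 hx)]) 0
  rw [lintegral_indicator_one hA] at hmain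
  have hs0 : expSum r (0 : Fin n → ℝ) = 2 * n := by
    simp only [expSum, Pi.zero_apply, mul_zero, neg_zero, expENN_zero]
    simp only [Finset.sum_const, Finset.card_univ, Fintype.card_fin, nsmul_eq_mul]
    norm_num
    ring
  rw [hs0] at hmain
  have hmarkov : expENN t * π (A ∩ {x | expENN t ≤ expSupDev μ a w L 0 x}) ≤
      ∫⁻ x, A.indicator 1 x * expSupDev μ a w L 0 x ∂π := by
    refine le_trans ?_ (mul_meas_ge_le_lintegral ((measurable_one.indicator hA).mul hm) (expENN t))
    gcongr
    rintro x ⟨hxA, hx⟩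
    simpa [hxA] using hx
  have hinv : expENN (-t) * expENN t = 1 := by
    rw [← expENN_add, neg_add_cancel, expENN_zero]
  calc _ = expENN (-t) * (expENN t * π (A ∩ {x | expENN t ≤ expSupDev μ a w L 0 x})) := by
        rw [← mul_assoc, hinv, one_mul]
    _ ≤ expENN (-t) * (2 * n * K ^ L.card * π A) := mul_le_mul_right (hmarkov.trans hmain) _
    _ = _ := by ring

end Columns

/-! ### The deterministic comparison. -/

/-- A vector outside the support of the constraint vector cannot improve the objective as soon as
the columns vanishing on that support dominate. -/
theorem IsL1Solution.support_subset {n p : ℕ} {X : Matrix (Fin n) (Fin p) ℝ} {i j : Fin p}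
    (hX : ∀ v : Fin n → ℝ, v ≠ 0 → (∀ k ∈ pairSupport X i j, v k = 0) →
      0 < ∑ l ∈ Finset.univ \ {i, j}, vanishSign (pairSupport X i j) (X.col l) * |v ⬝ᵥ X.col l|)
    {z : Fin n → ℝ} (hz : IsL1Solution X (pairSum X i j) z) :
    Function.support z ⊆ pairSupport X i j := by
  classical
  set I := pairSupport X i j with hI
  set zI : Fin n → ℝ := I.indicator z with hzI
  set v : Fin n → ℝ := z - zI with hv
  have hvI : ∀ k ∈ I, v k = 0 := fun k hk => by simp [hv, hzI, hk]
  have hcol : ∀ l ∈ ({i, j} : Finset (Fin p)), v ⬝ᵥ X.col l = 0 := fun l hl => by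
    refine Finset.sum_eq_zero fun k _ => ?_
    by_cases hk : k ∈ I
    · rw [hvI k hk, zero_mul]
    · rw [hI, pairSupport, Set.mem_union, not_or, Function.notMem_support,
        Function.notMem_support] at hk
      simp only [Finset.mem_insert, Finset.mem_singleton] at hl
      rcases hl with rfl | rfl
      · rw [hk.1, mul_zero]
      · rw [hk.2, mul_zero]
  by_contra hsub
  have hv0 : v ≠ 0 := by
    obtain ⟨k, hk, hkI⟩ := Set.not_subset.1 hsub
    intro h0
    have := congrFun h0 k
    simp only [hv, hzI, Pi.sub_apply, Set.indicator_of_notMem hkI, sub_zero, Pi.zero_apply] at this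
    exact hk this
  have hb : pairSum X i j ⬝ᵥ zI = 1 := by
    have h1 : pairSum X i j ⬝ᵥ v = 0 := by
      rw [pairSum, add_dotProduct, dotProduct_comm, hcol i (by simp), dotProduct_comm,
        hcol j (by simp), add_zero]
    rw [hv, dotProduct_sub, hz.1] at h1
    linarith
  have hle := hz.2 zI hb
  -- If the column vanishes on `I` then `zI` is orthogonal to it and equality holds; otherwise this
  -- is the reverse triangle inequality.
  have hpt : ∀ l, |zI ⬝ᵥ X.col l| + vanishSign I (X.col l) * |v ⬝ᵥ X.col l| ≤ |z ⬝ᵥ X.col l| := by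
    intro l
    have hzv : z ⬝ᵥ X.col l = zI ⬝ᵥ X.col l + v ⬝ᵥ X.col l := by
      rw [← add_dotProduct, hv, add_sub_cancel]
    unfold vanishSign
    split_ifs with h
    · have : zI ⬝ᵥ X.col l = 0 := Finset.sum_eq_zero fun k _ => by
        by_cases hk : k ∈ I
        · rw [h k hk, mul_zero]
        · rw [hzI, Set.indicator_of_notMem hk, zero_mul]
      rw [hzv, this]
      simp
    · have := abs_sub_abs_le_abs_add (zI ⬝ᵥ X.col l) (v ⬝ᵥ X.col l)
      rw [hzv]
      linarith
  have hsum : ∑ l, vanishSign I (X.col l) * |v ⬝ᵥ X.col l| =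
      ∑ l ∈ Finset.univ \ {i, j}, vanishSign I (X.col l) * |v ⬝ᵥ X.col l| := by
    rw [← Finset.sum_sdiff (Finset.subset_univ {i, j}), add_eq_left]
    refine Finset.sum_eq_zero fun l hl => ?_
    rw [hcol l hl, abs_zero, mul_zero]
  have htot : l1Norm (Matrix.vecMul zI X) + ∑ l, vanishSign I (X.col l) * |v ⬝ᵥ X.col l| ≤
      l1Norm (Matrix.vecMul z X) := by
    rw [l1Norm, l1Norm, ← Finset.sum_add_distrib]
    exact Finset.sum_le_sum fun l _ => hpt l
  have := hX v hv0 hvI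
  linarith

theorem l1Norm_smul {n : ℕ} (c : ℝ) (v : Fin n → ℝ) : l1Norm (c • v) = |c| * l1Norm v := by
  simp [l1Norm, abs_mul, Finset.mul_sum]

theorem l1Norm_pos {n : ℕ} {v : Fin n → ℝ} (hv : v ≠ 0) : 0 < l1Norm v := by
  obtain ⟨k, hk⟩ := Function.ne_iff.1 hv
  exact Finset.sum_pos' (fun _ _ => abs_nonneg _) ⟨k, Finset.mem_univ k, abs_pos.2 hk⟩

/-! ### The exceptional event. -/

/-- The matrix with the given columns. -/
def ofColumns {n p : ℕ} (x : Fin p → Fin n → ℝ) : Matrix (Fin n) (Fin p) ℝ :=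
  Matrix.of fun k l => x l k

theorem pairSupport_ofColumns {n p : ℕ} (x : Fin p → Fin n → ℝ) (i j : Fin p) :
    pairSupport (ofColumns x) i j = Function.support (x i) ∪ Function.support (x j) := rfl

theorem measurableSet_pairSupport_eq {n p : ℕ} (i j : Fin p) (I : Set (Fin n)) :
    MeasurableSet {x : Fin p → Fin n → ℝ | pairSupport (ofColumns x) i j = I} := by
  have : {x : Fin p → Fin n → ℝ | pairSupport (ofColumns x) i j = I} =
      ⋂ k, {x | (x i k ≠ 0 ∨ x j k ≠ 0) ↔ k ∈ I} := by
    ext x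
    simp [Set.ext_iff, pairSupport, ofColumns, Matrix.col]
  rw [this]
  refine MeasurableSet.iInter fun k => ?_
  have hm : ∀ l : Fin p, MeasurableSet {x : Fin p → Fin n → ℝ | x l k ≠ 0} := fun l =>
    (measurableSet_eq_fun (f := fun x : Fin p → Fin n → ℝ => x l k) (by fun_prop)
      measurable_const).compl
  by_cases hk : k ∈ I
  · simp only [hk, iff_true]
    exact (hm i).union (hm j)
  · simp only [hk, iff_false]
    exact ((hm i).union (hm j)).compl

section Probability

variable {ν : Measure ℝ} [IsProbabilityMeasure ν] {θ : ℝ} {n p : ℕ}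

/-- For a fixed small set `I`, outside an event of small conditional probability, the columns
vanishing on `I` dominate uniformly over all vectors vanishing on `I`. -/
theorem SparseMoments.exists_measurableSet_of_pairSupport_eq (h : SparseMoments ν θ)
    (hθn : 2 ≤ θ * n) (hp : 2 < p) {i j : Fin p} (hij : i ≠ j) (I : Finset (Fin n))
    (hI : θ * I.card ≤ 1 / 8) :
    ∃ B : Set (Fin p → Fin n → ℝ), MeasurableSet B ∧
      (Measure.pi fun _ : Fin p => Measure.pi fun _ : Fin n => ν) B ≤
        2 * n * expENN (-((1 / 5600) ^ 2 / 192 * (p - 2) / n)) *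
          (Measure.pi fun _ : Fin p => Measure.pi fun _ : Fin n => ν)
            {x | pairSupport (ofColumns x) i j = I} ∧
      ∀ x ∉ B, pairSupport (ofColumns x) i j = I → ∀ v : Fin n → ℝ, v ≠ 0 → (∀ k ∈ I, v k = 0) →
        0 < ∑ l ∈ Finset.univ \ {i, j}, vanishSign I (x l) * |v ⬝ᵥ x l| := by
  have hn0 : (0 : ℝ) < n := by
    rcases Nat.eq_zero_or_pos n with rfl | hn
    · norm_num at hθn
    · exact_mod_cast hn
  have hθ : 0 < θ := by
    by_contra hneg
    push Not at hneg
    nlinarith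
  have hn : 0 < n := by exact_mod_cast hn0
  set q := √(θ * n) with hq
  have hq2 : q ^ 2 = θ * n := Real.sq_sqrt (by linarith)
  have hq1 : 1 ≤ q := by rw [hq, Real.one_le_sqrt]; linarith
  have hq0 : 0 < q := by linarith
  set μ := Measure.pi fun _ : Fin n => ν with hμ
  set L : Finset (Fin p) := Finset.univ \ {i, j} with hL
  have hLcard : (L.card : ℝ) = p - 2 := by
    rw [hL, Finset.card_sdiff_of_subset (Finset.subset_univ _), Finset.card_pair hij,
      Finset.card_univ, Fintype.card_fin, Nat.cast_sub hp.le]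
    norm_num
  have hm0 : (0 : ℝ) < L.card := by
    rw [hLcard]
    have : (2 : ℝ) < p := by exact_mod_cast hp
    linarith
  set S : Set (Fin n → ℝ) := {v | (∀ k ∈ I, v k = 0) ∧ l1Norm v = 1} with hS
  -- A countable dense subset of the normalized vectors keeps the supremum measurable.
  obtain ⟨T, hTc, hTd⟩ := TopologicalSpace.exists_countable_dense S
  have : Countable T := hTc.to_subtype
  -- With `r = ρ/q` the exponent per column is `12θr² - rd/2 = (12ρ² - ρ/11200)/n`. It is minimal at
  -- `ρ = 1/(5600 * 48)`, with value `-(1/5600)²/(192 n)`.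
  set r : ℝ := 1 / (5600 * 48) / q with hr
  have hr0 : 0 < r := by positivity
  set w : T → Fin n → ℝ := fun v => r • ((v : S) : Fin n → ℝ) with hw
  set d : ℝ := θ / (5600 * q) with hd
  have hd0 : 0 < d := by positivity
  set t : ℝ := L.card * (r * (d / 2)) with ht
  have ha := vanishSign_eq_or (I : Set (Fin n))
  have ham := measurable_vanishSign (I : Set (Fin n))
  have hwr : ∀ v : T, l1Norm (w v) ≤ r := fun v => by
    rw [hw, l1Norm_smul, (v : S).2.2, mul_one, abs_of_pos hr0]
  have hK : ∀ k, ∫⁻ y, ENNReal.ofReal (Real.cosh (2 * r * y k)) ∂μ ≤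
      expENN (3 * θ * (2 * r) ^ 2) := fun k => by
    rw [(measurePreserving_eval (fun _ : Fin n => ν) k).lintegral_comp
      (f := fun y : ℝ => ENNReal.ofReal (Real.cosh (2 * r * y)))
      (Real.measurable_cosh.comp (by fun_prop)).ennreal_ofReal]
    refine h.cosh_le (2 * r) ?_
    rw [abs_of_pos (by positivity)]
    have : r ≤ 1 / (5600 * 48) := div_le_self (by norm_num) hq1
    linarith
  have hA := measurableSet_pairSupport_eq i j (I : Set (Fin n))
  set B := {x : Fin p → Fin n → ℝ | pairSupport (ofColumns x) i j = I} ∩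
    {x | expENN t ≤ expSupDev μ (vanishSign I) w L 0 x} with hB
  refine ⟨B, hA.inter (measurableSet_le measurable_const (by fun_prop)), ?_, ?_⟩
  · refine (measure_inter_expSupDev_le hn ha ham hwr
      (fun v => h.integrable_vanishSign_mul I (w v)) hK hA L ?_ t).trans ?_
    · intro l hl x y
      simp only [hL, Finset.mem_sdiff, Finset.mem_univ, true_and, Finset.mem_insert,
        Finset.mem_singleton, not_or] at hl
      have hi : Function.update x l y i = x i := Function.update_of_ne (Ne.symm hl.1) _ _
      have hj : Function.update x l y j = x j := Function.update_of_ne (Ne.symm hl.2) _ _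
      rw [Set.mem_ofPred_eq, Set.mem_ofPred_eq, pairSupport_ofColumns, pairSupport_ofColumns, hi, hj]
    · refine mul_le_mul_left ?_ _
      rw [mul_assoc]
      refine mul_le_mul_right ?_ _
      have hpow : expENN (3 * θ * (2 * r) ^ 2) ^ L.card =
          expENN (L.card * (3 * θ * (2 * r) ^ 2)) := by
        rw [expENN, expENN, ← ENNReal.ofReal_pow (Real.exp_pos _).le, Real.exp_nat_mul]
      rw [hpow, ← expENN_add]
      refine expENN_mono (le_of_eq ?_)
      have hqn : θ * q⁻¹ ^ 2 = (n : ℝ)⁻¹ := by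
        rw [inv_pow, hq2]
        field_simp
      rw [ht, ← hLcard, hd, hr, div_eq_mul_inv (1 / (5600 * 48)), div_eq_mul_inv _ (n : ℝ),
        div_eq_mul_inv θ, mul_inv]
      linear_combination (-(L.card * ((1 / 5600) ^ 2 / 192)) : ℝ) * hqn
  · intro x hxB hxI v hv0 hvI
    by_contra hneg
    rw [not_lt] at hneg
    refine hxB ⟨hxI, ?_⟩
    set F : (Fin n → ℝ) → ℝ := fun v => ∑ l ∈ L, vanishSign I (x l) * |v ⬝ᵥ x l| with hF
    have hFsmul : ∀ (c : ℝ) v, 0 ≤ c → F (c • v) = c * F v := fun c v hc => by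
      simp only [hF, smul_dotProduct, smul_eq_mul, abs_mul, abs_of_nonneg hc, Finset.mul_sum]
      exact Finset.sum_congr rfl fun l _ => by ring
    have hFc : Continuous F := by
      simp only [hF, dotProduct]
      fun_prop
    have hvpos := l1Norm_pos hv0
    have hv₁ : (l1Norm v)⁻¹ • v ∈ S := by
      refine ⟨fun k hk => by simp [hvI k hk], ?_⟩
      rw [l1Norm_smul, abs_of_pos (inv_pos.2 hvpos), inv_mul_cancel₀ hvpos.ne']
    -- A bad `v` has `F v ≤ 0`, so by density some `u` in `T` has `F u < L.card * (d / 4)`. The mean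
    -- is at least `3d/4` per column, which leaves a deviation of `d/2` per column, scaled by `r`:
    -- this is `t`.
    have hopen : IsOpen {u : S | F u < L.card * (d / 4)} :=
      isOpen_lt (hFc.comp continuous_subtype_val) continuous_const
    obtain ⟨u, hu, huT⟩ := hTd.exists_mem_open hopen ⟨⟨_, hv₁⟩, by
      rw [Set.mem_ofPred_eq, hFsmul _ _ (inv_pos.2 hvpos).le]
      exact (mul_nonpos_of_nonneg_of_nonpos (inv_pos.2 hvpos).le hneg).trans_lt (by positivity)⟩
    change expENN t ≤ expSupDev μ (vanishSign I) w L 0 x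
    unfold expSupDev
    refine le_iSup_of_le (⟨u, hu⟩ : T) (expENN_mono ?_)
    rw [dotProduct_zero, zero_add, Finset.sum_sub_distrib, Finset.sum_const, nsmul_eq_mul]
    have hD : r * (3 / 4 * d) ≤ ∫ y, vanishSign I y * |w ⟨u, hu⟩ ⬝ᵥ y| ∂μ := by
      have h1 := h.le_integral_abs_dotProduct hθn (w ⟨u, hu⟩)
      have h2 := h.integral_vanishSign_mul I hI (w ⟨u, hu⟩) fun k hk => by
        simp [hw, u.2.1 k hk]
      rw [hw, l1Norm_smul, u.2.2, mul_one, abs_of_pos hr0] at h1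
      refine le_trans (le_of_eq ?_) ((mul_le_mul_of_nonneg_left h1 (by norm_num)).trans h2)
      ring
    have hFu : ∑ l ∈ L, vanishSign I (x l) * |w ⟨u, hu⟩ ⬝ᵥ x l| ≤ r * (L.card * (d / 4)) := by
      have := hFsmul r u hr0.le
      simp only [hF] at this
      rw [hw, this]
      exact mul_le_mul_of_nonneg_left (le_of_lt huT) hr0.le
    have := mul_le_mul_of_nonneg_left hD hm0.le
    rw [ht]
    linarith

theorem SparseMoments.exists_measurableSet_pair (h : SparseMoments ν θ)
    (hθn : 2 ≤ θ * n) (hp : 2 < p) {i j : Fin p} (hij : i ≠ j) :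
    ∃ B : Set (Fin p → Fin n → ℝ), MeasurableSet B ∧
      (Measure.pi fun _ : Fin p => Measure.pi fun _ : Fin n => ν) B ≤
        2 * n * expENN (-((1 / 5600) ^ 2 / 192 * (p - 2) / n)) ∧
      ∀ x ∉ B, θ * (pairSupport (ofColumns x) i j).ncard ≤ 1 / 8 →
        ∀ z, IsL1Solution (ofColumns x) (pairSum (ofColumns x) i j) z →
          Function.support z ⊆ pairSupport (ofColumns x) i j := by
  classical
  set π := Measure.pi fun _ : Fin p => Measure.pi fun _ : Fin n => ν with hπ
  set δ : ENNReal := 2 * n * expENN (-((1 / 5600) ^ 2 / 192 * (p - 2) / n)) with hδ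
  have key : ∀ I : Finset (Fin n), ∃ B : Set (Fin p → Fin n → ℝ), MeasurableSet B ∧
      π B ≤ δ * π {x | pairSupport (ofColumns x) i j = I} ∧ (θ * I.card ≤ 1 / 8 →
      ∀ x ∉ B, pairSupport (ofColumns x) i j = I → ∀ v : Fin n → ℝ, v ≠ 0 → (∀ k ∈ I, v k = 0) →
        0 < ∑ l ∈ Finset.univ \ {i, j}, vanishSign I (x l) * |v ⬝ᵥ x l|) := fun I => by
    by_cases hI : θ * I.card ≤ 1 / 8
    · obtain ⟨B, h1, h2, h3⟩ := h.exists_measurableSet_of_pairSupport_eq hθn hp hij I hI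
      exact ⟨B, h1, h2, fun _ => h3⟩
    · exact ⟨∅, MeasurableSet.empty, by simp, fun hI' => absurd hI' hI⟩
  choose B hBm hBle hB using key
  refine ⟨⋃ I, B I, MeasurableSet.iUnion hBm, ?_, ?_⟩
  · calc π (⋃ I, B I) ≤ ∑ I, π (B I) := measure_iUnion_fintype_le _ _
      _ ≤ ∑ I : Finset (Fin n), δ * π {x | pairSupport (ofColumns x) i j = I} :=
        Finset.sum_le_sum fun I _ => hBle I
      -- The events `I_{ij} = I` are disjoint, so the sum over all `I` is no larger than a single
      -- `δ`.
      _ = δ * π (⋃ I : Finset (Fin n), {x | pairSupport (ofColumns x) i j = I}) := by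
        rw [← Finset.mul_sum, measure_iUnion, tsum_fintype]
        · intro I I' hII'
          rw [Function.onFun, Set.disjoint_left]
          intro x hx hx'
          exact hII' (Finset.coe_injective (Eq.trans (Eq.symm hx) hx'))
        · exact fun I => measurableSet_pairSupport_eq i j (I : Set (Fin n))
      _ ≤ δ := mul_le_of_le_one_right' prob_le_one
  · intro x hx hcard z hz
    set I := (pairSupport (ofColumns x) i j).toFinite.toFinset with hI
    have hIeq : (I : Set (Fin n)) = pairSupport (ofColumns x) i j := Set.Finite.coe_toFinset _
    have hIcard : θ * I.card ≤ 1 / 8 := by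
      rwa [hI, ← Set.ncard_eq_toFinset_card]
    refine hz.support_subset fun v hv0 hv => ?_
    have := hB I hIcard x (fun hxI => hx (Set.mem_iUnion.2 ⟨I, hxI⟩)) hIeq.symm v hv0
      fun k hk => hv k (by rw [← hIeq]; exact hk)
    rw [hIeq] at this
    exact this

theorem SparseMoments.exists_measurableSet_propertyP1 (h : SparseMoments ν θ)
    (hθn : 2 ≤ θ * n) (hp : 2 < p) :
    ∃ B : Set (Fin p → Fin n → ℝ), MeasurableSet B ∧
      (Measure.pi fun _ : Fin p => Measure.pi fun _ : Fin n => ν) B ≤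
        p ^ 2 * (2 * n * expENN (-((1 / 5600) ^ 2 / 192 * (p - 2) / n))) ∧
      ∀ x ∉ B, PropertyP1 θ (ofColumns x) := by
  have hθ : 0 < θ := by
    by_contra hneg
    push Not at hneg
    nlinarith [(Nat.cast_nonneg n : (0 : ℝ) ≤ n)]
  set π := Measure.pi fun _ : Fin p => Measure.pi fun _ : Fin n => ν with hπ
  set δ : ENNReal := 2 * n * expENN (-((1 / 5600) ^ 2 / 192 * (p - 2) / n)) with hδ
  have key : ∀ a : Fin p × Fin p, ∃ B : Set (Fin p → Fin n → ℝ), MeasurableSet B ∧ π B ≤ δ ∧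
      (a.1 ≠ a.2 → ∀ x ∉ B, θ * (pairSupport (ofColumns x) a.1 a.2).ncard ≤ 1 / 8 →
        ∀ z, IsL1Solution (ofColumns x) (pairSum (ofColumns x) a.1 a.2) z →
          Function.support z ⊆ pairSupport (ofColumns x) a.1 a.2) := fun a => by
    by_cases ha : a.1 ≠ a.2
    · obtain ⟨B, h1, h2, h3⟩ := h.exists_measurableSet_pair hθn hp ha
      exact ⟨B, h1, h2, fun _ => h3⟩
    · exact ⟨∅, MeasurableSet.empty, by simp, fun ha' => absurd ha' ha⟩
  choose B hBm hBle hB using key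
  refine ⟨⋃ a, B a, MeasurableSet.iUnion hBm, ?_, fun x hx i j hij => ?_⟩
  · calc π (⋃ a, B a) ≤ ∑ a, π (B a) := measure_iUnion_fintype_le _ _
      _ ≤ ∑ _ : Fin p × Fin p, δ := Finset.sum_le_sum fun a _ => hBle a
      _ = p ^ 2 * δ := by simp [sq]
  · by_cases hc : θ * (pairSupport (ofColumns x) i j).ncard ≤ 1 / 8
    · exact Or.inr (hB (i, j) hij.ne x (fun hxB => hx (Set.mem_iUnion.2 ⟨(i, j), hxB⟩)) hc)
    · refine Or.inl (Or.inr ⟨?_, ?_⟩)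
      · rw [div_lt_iff₀ (by positivity)]
        linarith
      · simpa using Set.ncard_le_card (pairSupport (ofColumns x) i j)

end Probability

/-! ### The sample size and the conclusion. -/

/-- The assumption bounds `p` below through `log n`, while the union bound needs `log p`. The
inequality `log x ≤ x - 1` at `x = p/(2Dn)` passes from one to the other and gives `D n log p ≤ p`.
As `p - 2 ≥ p/2` and `D = 12/κ`, the exponential is at most `p⁻⁶`, enough to absorb `p²` and `2n ≤
p`. -/
theorem exists_sampleSize_constant {κ : ℝ} (hκ : 0 < κ) (hκ1 : κ ≤ 1) :
    ∃ C : ℝ, 0 < C ∧ ∀ n p : ℕ, 2 ≤ n → C * n * Real.log n < p →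
      4 ≤ p ∧ p ^ 2 * (2 * n * Real.exp (-(κ * (p - 2) / n))) ≤ 1 / (p : ℝ) ^ 2 := by
  set D := 12 / κ with hD
  have hD12 : 12 ≤ D := by rw [hD, le_div_iff₀ hκ]; linarith
  have hlogD : 0 ≤ Real.log (2 * D) := Real.log_nonneg (by linarith)
  refine ⟨2 * D * (2 * Real.log (2 * D) + 1), by positivity, fun n p hn hp => ?_⟩
  have hn2 : (2 : ℝ) ≤ n := by exact_mod_cast hn
  have hlogn : 1 / 2 ≤ Real.log n := by
    have h1 := Real.log_two_gt_d9
    have h2 := Real.log_le_log two_pos hn2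
    linarith
  set A := D * n * Real.log n with hA
  have hA6 : 6 * n ≤ A := by
    have : 12 * (n : ℝ) * (1 / 2) ≤ D * n * Real.log n := by gcongr
    linarith
  have hp' : 2 * A * (2 * Real.log (2 * D) + 1) < p := by
    refine lt_of_eq_of_lt ?_ hp
    rw [hA]; ring
  have hp2A : 2 * A < p := by nlinarith
  have hp24 : 24 < (p : ℝ) := by linarith
  have hp0 : (0 : ℝ) < p := by linarith
  have hlogp : D * n * Real.log p ≤ p := by
    have hx : 0 < (p : ℝ) / (2 * D * n) := by positivity
    have h1 := Real.log_le_sub_one_of_pos hx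
    rw [Real.log_div hp0.ne' (by positivity), Real.log_mul (by positivity) (by positivity)] at h1
    have h2 : D * n * (p / (2 * D * n)) = p / 2 := by field_simp
    have h3 : D * n * Real.log (2 * D) ≤ 2 * A * Real.log (2 * D) := by
      refine mul_le_mul_of_nonneg_right ?_ hlogD
      rw [hA]
      have : D * n * 1 ≤ D * n * (2 * Real.log n) := by gcongr; linarith
      linarith
    have h4 : D * n * Real.log p ≤
        D * n * (p / (2 * D * n) + Real.log (2 * D) + Real.log n) := by
      gcongr
      linarith
    rw [mul_add, mul_add, h2] at h4
    linarith
  refine ⟨by exact_mod_cast (by linarith : (4 : ℝ) ≤ p), ?_⟩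
  have hexp : Real.exp (-(κ * (p - 2) / n)) ≤ 1 / (p : ℝ) ^ 6 := by
    rw [one_div, ← Real.rpow_natCast, ← Real.rpow_neg hp0.le, Real.rpow_def_of_pos hp0]
    refine Real.exp_le_exp.2 ?_
    have h1 : 6 * Real.log p ≤ κ * (p - 2) / n := by
      rw [le_div_iff₀ (by linarith)]
      have h2 : κ * (D * n * Real.log p) ≤ κ * p := by gcongr
      have h3 : κ * (D * n * Real.log p) = 12 * (n * Real.log p) := by
        rw [hD]; field_simp
      nlinarith
    push_cast
    linarith
  calc (p : ℝ) ^ 2 * (2 * n * Real.exp (-(κ * (p - 2) / n)))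
      ≤ p ^ 2 * (p * (1 / (p : ℝ) ^ 6)) := by
        gcongr
        linarith
    _ = 1 / (p : ℝ) ^ 2 * (1 / p) := by field_simp
    _ ≤ 1 / (p : ℝ) ^ 2 := mul_le_of_le_one_right (by positivity)
        (by rw [div_le_one hp0]; linarith)

theorem mainTheorem3 :
    ∃ C α : ℝ, 0 < C ∧ 0 < α ∧
      ∀ (Ω : Type*) [MeasurableSpace Ω] (P : Measure Ω) [IsProbabilityMeasure P]
        (n p : ℕ) (θ : ℝ) (χ R : Fin n → Fin p → Ω → ℝ),
        0 < n →
        BernoulliSubgaussian P θ χ R →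
        2 / (n : ℝ) ≤ θ → θ ≤ α / Real.sqrt n →
        C * n * Real.log n < p →
        ∃ E : Set Ω, MeasurableSet E ∧ 1 - 1 / (p : ℝ) ^ 2 ≤ P.real E ∧
          ∀ ω ∈ E, PropertyP1 θ (sparseMatrix χ R ω) := by
  obtain ⟨C, hC, hCp⟩ := exists_sampleSize_constant (κ := (1 / 5600) ^ 2 / 192) (by norm_num)
    (by norm_num)
  refine ⟨C, 1, hC, one_pos, fun Ω _ P _ n p θ χ R hn hX hθ _ hp => ?_⟩
  have hn0 : (0 : ℝ) < n := by exact_mod_cast hn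
  have hp0 : 0 < p := by
    have : 0 ≤ C * n * Real.log n :=
      mul_nonneg (by positivity) (Real.log_natCast_nonneg n)
    exact_mod_cast this.trans_lt hp
  obtain ⟨-, hθ1, ν, hν, hmom, hlaw⟩ := hX.exists_law hn hp0
  have hθn : 2 ≤ θ * n := (div_le_iff₀ hn0).1 hθ
  -- From `2 ≤ θ n` and `θ ≤ 1`; it keeps `log n` away from zero.
  have hn2 : 2 ≤ n := by
    have : (2 : ℝ) ≤ n := by nlinarith
    exact_mod_cast this
  obtain ⟨hp4, hsmall⟩ := hCp n p hn2 hp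
  obtain ⟨B, hBm, hBle, hB⟩ := hmom.exists_measurableSet_propertyP1 hθn (p := p) (by omega)
  set Y : Ω → Fin p → Fin n → ℝ := fun ω l k => χ k l ω * R k l ω with hY
  have hYm : Measurable Y := measurable_pi_lambda _ fun l => measurable_pi_lambda _ fun k =>
    (hX.measurable_χ k l).mul (hX.measurable_R k l)
  refine ⟨(Y ⁻¹' B)ᶜ, (hYm hBm).compl, ?_, fun ω hω => hB (Y ω) hω⟩
  rw [probReal_compl_eq_one_sub (hYm hBm)]
  refine sub_le_sub_left ?_ 1
  rw [← hlaw, Measure.map_apply hYm hBm] at hBle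
  rw [measureReal_def]
  refine ENNReal.toReal_le_of_le_ofReal (by positivity) (hBle.trans ?_)
  refine le_trans (le_of_eq ?_) (ENNReal.ofReal_le_ofReal hsmall)
  rw [expENN, ENNReal.ofReal_mul (by positivity), ENNReal.ofReal_mul (by positivity),
    ENNReal.ofReal_mul (by positivity), ENNReal.ofReal_pow (by positivity)]
  simp
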